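/- **Setting.** Let $N\ge 2$, let $\Omega\subset\mathbb{R}^N$ be a bounded open set, and let $0<\alpha\le\beta$ and $c>0$. Write $B^{sym}=\frac12(B+B^t)$ and $B^{skew}=\frac12(B-B^t)$ for $B\in L^2(\Omega;\mathbb{M}^N)$, where $\mathbb{M}^N$ is the space of real $N\times N$ matrices, and let $\mathbb{S}^N_{sym},\mathbb{S}^N_{skew}\subset\mathbb{M}^N$ be the symmetric and the skew-symmetric matrices. For $A,B\in L^2(\Omega;\mathbb{S}^N_{skew})$ write $A\preceq B$ if $|a_{ij}|\le|b_{ij}|$ a.e. in $\Omega$ for all $i<j$. Let $Q\subset L^2(\Omega;\mathbb{S}^N_{skew})$ be convex and compact with $0\in Q$, let $A^*\in L^2(\Omega;\mathbb{S}^N_{skew})$, and let $A^*_k\in L^\infty(\Omega;\mathbb{S}^N_{skew})$, $k\in\mathbb{N}$, be any sequence with $A^*_k\to A^*$ strongly in $L^2$. Let $y_d\in L^2(\Omega)$ and $f\in H^{-1}(\Omega)=(H^1_0(\Omega))^*$, where $H^1_0(\Omega)$ is the closure of $C_0^\infty(\Omega)$ in $H^1(\Omega)$. **Controls.** Let $\mathfrak{A}_{ad,1}$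 be the set of symmetric matrix functions $S=[s_{ij}]$ on $\Omega$ with $\alpha I\le S(x)\le\beta I$ for a.e. $x\in\Omega$ (as quadratic forms) and total variation $TV(s_{ij})\le c$ in $\Omega$ for $i\le j$. Let $$\mathfrak{A}_{ad}=\{A\in L^2(\Omega;\mathbb{M}^N): A^{sym}\in\mathfrak{A}_{ad,1},\ A^{skew}\in Q,\ A^{skew}\preceq A^*\},$$ $$\mathfrak{A}_{ad}^k=\{A\in L^2(\Omega;\mathbb{M}^N): A^{sym}\in\mathfrak{A}_{ad,1},\ A^{skew}\in Q,\ A^{skew}\preceq A^*_k\}.$$ **Forms.** For $A\in L^2(\Omega;\mathbb{M}^N)$, $y\in H^1_0(\Omega)$, $\varphi\in C^\infty_0(\Omega)$ put $[y,\varphi]_A=\int_\Omega(\nabla\varphi,A^{skew}\nabla y)\,dx$. Let $D(A)$ be the set of all $y\in H_0^1(\Omega)$ for which there is a constant $C$ with $|[y,\varphi]_A|\le C\,\|\nabla\varphi\|_{L^2(\Omega)}$ for all $\varphi\in C_0^\infty(\Omega)$. For $y\in D(A)$ and $v\in H^1_0(\Omega)$ let $[y,v]_A=\lim[y,\varphi]_A$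 as $\varphi\to v$ in $H^1_0(\Omega)$, $\varphi\in C^\infty_0(\Omega)$. **Problems.** Let $I(A,y)=\|y-y_d\|^2_{L^2(\Omega)}+\int_\Omega(\nabla y,A^{sym}\nabla y)\,dx$. Let $\Xi$ be the set of pairs $(A,y)$ with $A\in\mathfrak{A}_{ad}$, $y\in D(A)$ and $\int_\Omega(A^{sym}\nabla y,\nabla v)\,dx+[y,v]_A=\langle f,v\rangle$ for all $v\in H^1_0(\Omega)$. Let $\Xi_k$ be the set of pairs $(A,y)$ with $A\in\mathfrak{A}^k_{ad}$, $y\in H_0^1(\Omega)$ and $\int_\Omega(\nabla\varphi,A^{sym}\nabla y+A^{skew}\nabla y)\,dx=\langle f,\varphi\rangle$ for all $\varphi\in C^\infty_0(\Omega)$. Let $\tau$ be the product of the strong topology of $L^2(\Omega;\mathbb{M}^N)$ and the weak topology of $H^1_0(\Omega)$. **Theorem.** 1. For every $k$ and every $A\in\mathfrak{A}_{ad}^k$ there is exactly one $y\in H_0^1(\Omega)$ with $(A,y)\in\Xi_k$. 2. For every $k$ the functional $I$ attains its minimum over $\Xi_k$. 3. If $(A^0_k,y^0_k)\in\Xi_k$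 is a minimizer of $I$ over $\Xi_k$ for every $k$, then the sequence $\{(A_k^0,y_k^0)\}_{k\in\mathbb{N}}$ is relatively compact with respect to $\tau$, and each of its $\tau$-cluster pairs $(\widehat A,\widehat y)$ satisfies $(\widehat A,\widehat y)\in\Xi$ and $[\widehat y,\widehat y]_{\widehat A}\ge0$. -/

import Mathlib

open MeasureTheory Filter Topology TopologicalSpace
open scoped ENNReal Distributions Gradient

-- The norm on matrices is the maximum of the absolute values of the entries.
attribute [local instance] Matrix.normedAddCommGroup Matrix.normedSpace

noncomputable section

namespace EllipticControl

/-- Euclidean space of dimension `N`. -/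
abbrev Vec (N : ℕ) : Type := EuclideanSpace ℝ (Fin N)

/-- Real `N × N` matrices. -/
abbrev Mat (N : ℕ) : Type := Matrix (Fin N) (Fin N) ℝ

/-- Lebesgue measure on the open set `Ω`. -/
abbrev leb {N : ℕ} (Ω : Opens (Vec N)) : Measure (Vec N) :=
  (volume : Measure (Vec N)).restrict (Ω : Set (Vec N))

/-- `L²(Ω)`. -/
abbrev L2 {N : ℕ} (Ω : Opens (Vec N)) : Type := Lp ℝ 2 (leb Ω)

/-- `L²(Ω; ℝᴺ)`. -/
abbrev L2Vec {N : ℕ} (Ω : Opens (Vec N)) : Type := Lp (Vec N) 2 (leb Ω)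

/-- `L²(Ω; 𝕄ᴺ)`, square-integrable matrix functions. -/
abbrev L2Mat {N : ℕ} (Ω : Opens (Vec N)) : Type := Lp (Mat N) 2 (leb Ω)

section Sobolev

variable {N : ℕ} {Ω : Opens (Vec N)}

theorem memLp_test (φ : 𝓓(Ω, ℝ)) : MemLp (φ : Vec N → ℝ) 2 (leb Ω) :=
  φ.continuous.memLp_of_hasCompactSupport φ.hasCompactSupport

theorem continuous_gradient_test (φ : 𝓓(Ω, ℝ)) : Continuous (∇ (φ : Vec N → ℝ)) :=
  (InnerProductSpace.toDual ℝ (Vec N)).symm.continuous.comp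
    (φ.contDiff.continuous_fderiv (by simp))

theorem hasCompactSupport_gradient_test (φ : 𝓓(Ω, ℝ)) :
    HasCompactSupport (∇ (φ : Vec N → ℝ)) :=
  (φ.hasCompactSupport.fderiv (𝕜 := ℝ)).comp_left
    (g := (InnerProductSpace.toDual ℝ (Vec N)).symm) (map_zero _)

theorem memLp_gradient_test (φ : 𝓓(Ω, ℝ)) : MemLp (∇ (φ : Vec N → ℝ)) 2 (leb Ω) :=
  (continuous_gradient_test φ).memLp_of_hasCompactSupport (hasCompactSupport_gradient_test φ)

theorem gradient_test_add (φ ψ : 𝓓(Ω, ℝ)) :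
    ∇ ((φ + ψ : 𝓓(Ω, ℝ)) : Vec N → ℝ) = ∇ (φ : Vec N → ℝ) + ∇ (ψ : Vec N → ℝ) := by
  funext x
  have h1 : DifferentiableAt ℝ (φ : Vec N → ℝ) x :=
    (φ.contDiff.differentiable (by simp)).differentiableAt
  have h2 : DifferentiableAt ℝ (ψ : Vec N → ℝ) x :=
    (ψ.contDiff.differentiable (by simp)).differentiableAt
  have h3 : ((φ + ψ : 𝓓(Ω, ℝ)) : Vec N → ℝ) = (φ : Vec N → ℝ) + (ψ : Vec N → ℝ) := rfl
  simp only [gradient, Pi.add_apply, h3, fderiv_add h1 h2, map_add]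

theorem gradient_test_smul (r : ℝ) (φ : 𝓓(Ω, ℝ)) :
    ∇ ((r • φ : 𝓓(Ω, ℝ)) : Vec N → ℝ) = r • ∇ (φ : Vec N → ℝ) := by
  funext x
  have h1 : DifferentiableAt ℝ (φ : Vec N → ℝ) x :=
    (φ.contDiff.differentiable (by simp)).differentiableAt
  have h3 : ((r • φ : 𝓓(Ω, ℝ)) : Vec N → ℝ) = r • (φ : Vec N → ℝ) := rfl
  simp only [gradient, Pi.smul_apply, h3, fderiv_const_smul h1 r, map_smul]

/-- The map `φ ↦ (φ, ∇φ)` from `C_c^∞(Ω)` to the Hilbert space `L²(Ω) × L²(Ω; ℝᴺ)`. The norm it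
induces on test functions is the `H¹(Ω)` norm. -/
def testPair (Ω : Opens (Vec N)) : 𝓓(Ω, ℝ) →ₗ[ℝ] WithLp 2 (L2 Ω × L2Vec Ω) where
  toFun φ := WithLp.toLp 2 ((memLp_test φ).toLp _, (memLp_gradient_test φ).toLp _)
  map_add' φ ψ := by
    rw [← WithLp.toLp_add, Prod.mk_add_mk, ← MemLp.toLp_add, ← MemLp.toLp_add]
    simp only [gradient_test_add]
    rfl
  map_smul' r φ := by
    rw [RingHom.id_apply, ← WithLp.toLp_smul, Prod.smul_mk, ← MemLp.toLp_const_smul,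
      ← MemLp.toLp_const_smul]
    simp only [gradient_test_smul]
    rfl

/-- `H¹₀(Ω)`, the closure of `C_c^∞(Ω)` in the `H¹(Ω)` norm, where a function `y` is stored
together with its weak gradient as the pair `(y, ∇y)`. -/
abbrev H10 (Ω : Opens (Vec N)) : Type :=
  ↥((LinearMap.range (testPair Ω)).topologicalClosure)

/-- A test function as an element of `H¹₀(Ω)`. -/
def testH10 (φ : 𝓓(Ω, ℝ)) : H10 Ω :=
  ⟨testPair Ω φ, Submodule.le_topologicalClosure _ (LinearMap.mem_range_self _ φ)⟩

/-- The underlying `L²` function of an element of `H¹₀(Ω)`. -/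
def H10.toL2 (y : H10 Ω) : L2 Ω := (y : WithLp 2 (L2 Ω × L2Vec Ω)).fst

/-- The weak gradient of an element of `H¹₀(Ω)`. -/
def H10.grad (y : H10 Ω) : L2Vec Ω := (y : WithLp 2 (L2 Ω × L2Vec Ω)).snd

end Sobolev

section Matrices

variable {N : ℕ} {Ω : Opens (Vec N)}

/-- Transposition on real matrices as a continuous linear map. -/
def transposeCLM (N : ℕ) : Mat N →L[ℝ] Mat N :=
  LinearMap.toContinuousLinearMap (Matrix.transposeLinearEquiv (Fin N) (Fin N) ℝ ℝ).toLinearMap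

/-- The pointwise transpose of a matrix function. -/
def transposeL2 (A : L2Mat Ω) : L2Mat Ω := (transposeCLM N).compLp A

/-- `Aˢʸᵐ = (A + Aᵗ) / 2`. -/
def symPart (A : L2Mat Ω) : L2Mat Ω := (1 / 2 : ℝ) • (A + transposeL2 A)

/-- `Aˢᵏᵉʷ = (A - Aᵗ) / 2`. -/
def skewPart (A : L2Mat Ω) : L2Mat Ω := (1 / 2 : ℝ) • (A - transposeL2 A)

/-- `L²(Ω; 𝕊ᴺ_sym)` inside `L²(Ω; 𝕄ᴺ)`. -/
def SymL2 (Ω : Opens (Vec N)) : Set (L2Mat Ω) := {A | ∀ᵐ x ∂leb Ω, (A x).transpose = A x}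

/-- `L²(Ω; 𝕊ᴺ_skew)` inside `L²(Ω; 𝕄ᴺ)`. -/
def SkewL2 (Ω : Opens (Vec N)) : Set (L2Mat Ω) := {A | ∀ᵐ x ∂leb Ω, (A x).transpose = -(A x)}

/-- The relation `A ⪯ B`: almost everywhere `|a_ij| ≤ |b_ij|` for all `i < j`. -/
def Prec (A B : L2Mat Ω) : Prop :=
  ∀ᵐ x ∂leb Ω, ∀ i j : Fin N, i < j → |A x i j| ≤ |B x i j|

/-- The divergence of a vector field. -/
def divergence (φ : Vec N → Vec N) (x : Vec N) : ℝ :=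
  ∑ i : Fin N, (fderiv ℝ φ x (EuclideanSpace.single i 1)) i

/-- The total variation over `Ω` of a locally integrable function: the supremum of `∫ g div φ`
over the `C¹` vector fields `φ` with compact support in `Ω` and `|φ| ≤ 1`. -/
def TV (Ω : Opens (Vec N)) (g : Vec N → ℝ) : ℝ≥0∞ :=
  ⨆ (φ : 𝓓^{1}(Ω, Vec N)) (_ : ∀ x, ‖φ x‖ ≤ 1),
    ENNReal.ofReal (∫ x, g x * divergence φ x ∂leb Ω)

/-- The symmetric matrices whose entries have total variation at most `c`. -/
def boundedTV (Ω : Opens (Vec N)) (c : ℝ) : Set (L2Mat Ω) :=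
  {S | S ∈ SymL2 Ω ∧ ∀ i j : Fin N, i ≤ j → TV Ω (fun x => S x i j) ≤ ENNReal.ofReal c}

/-- The symmetric matrices with `α I ≤ S(x) ≤ β I` almost everywhere, in the sense of quadratic
forms (such a matrix is automatically essentially bounded). -/
def elliptic (Ω : Opens (Vec N)) (α β : ℝ) : Set (L2Mat Ω) :=
  {S | S ∈ SymL2 Ω ∧ ∀ᵐ x ∂leb Ω, ∀ ξ : Vec N,
    α * ‖ξ‖ ^ 2 ≤ inner ℝ (Matrix.toEuclideanLin (S x) ξ) ξ ∧
      inner ℝ (Matrix.toEuclideanLin (S x) ξ) ξ ≤ β * ‖ξ‖ ^ 2}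

/-- Admissible symmetric parts. -/
def AdSym (Ω : Opens (Vec N)) (α β c : ℝ) : Set (L2Mat Ω) := boundedTV Ω c ∩ elliptic Ω α β

/-- Admissible skew parts for the compact set `Q` and the majorant `B`. -/
def AdSkew (Q : Set (L2Mat Ω)) (B : L2Mat Ω) : Set (L2Mat Ω) :=
  {K | K ∈ SkewL2 Ω ∧ K ∈ Q} ∩ {K | K ∈ SkewL2 Ω ∧ Prec K B}

/-- Admissible controls for the compact set `Q` and the majorant `B`. -/
def Ad (α β c : ℝ) (Q : Set (L2Mat Ω)) (B : L2Mat Ω) : Set (L2Mat Ω) :=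
  {A | symPart A ∈ AdSym Ω α β c ∧ skewPart A ∈ AdSkew Q B}

end Matrices

section Problem

variable {N : ℕ} {Ω : Opens (Vec N)}

/-- `∫_Ω (v, M ∇y) dx` for a vector field `v`. -/
def form (M : L2Mat Ω) (y : H10 Ω) (v : Vec N → Vec N) : ℝ :=
  ∫ x, inner ℝ (v x) (Matrix.toEuclideanLin (M x) (y.grad x)) ∂leb Ω

/-- `[y, φ]_A = ∫_Ω (∇φ, Aˢᵏᵉʷ ∇y) dx` for a test function `φ`. -/
def bracketTest (A : L2Mat Ω) (y : H10 Ω) (φ : 𝓓(Ω, ℝ)) : ℝ := form (skewPart A) y (∇ φ)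

/-- The set `D(A)` of all `y` for which `φ ↦ [y, φ]_A` is bounded on the test functions in the
norm `(∫_Ω |∇φ|²)^(1/2)`. -/
def D (A : L2Mat Ω) : Set (H10 Ω) :=
  {y | ∃ C : ℝ, ∀ φ : 𝓓(Ω, ℝ),
    |bracketTest A y φ| ≤ C * Real.sqrt (∫ x, ‖∇ (φ : Vec N → ℝ) x‖ ^ 2 ∂leb Ω)}

/-- `[y, v]_A` for `y ∈ D(A)` and `v ∈ H¹₀(Ω)`: the limit of `[y, φ]_A` as the test function `φ`
tends to `v` strongly in `H¹₀(Ω)`. -/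
def bracket (A : L2Mat Ω) (y v : H10 Ω) : ℝ :=
  limUnder (comap (testH10 (Ω := Ω)) (𝓝 v)) (bracketTest A y)

/-- `y` is a weak solution of `-div (A ∇y) = f` in `Ω`, `y = 0` on `∂Ω`. Here `H⁻¹(Ω)` is the
dual space of `H¹₀(Ω)`. -/
def IsWeakSolution (f : StrongDual ℝ (H10 Ω)) (A : L2Mat Ω) (y : H10 Ω) : Prop :=
  ∀ φ : 𝓓(Ω, ℝ), form (symPart A) y (∇ φ) + form (skewPart A) y (∇ φ) = f (testH10 φ)

/-- The cost `I(A, y) = ‖y - y_d‖² + ∫_Ω (∇y, Aˢʸᵐ ∇y) dx`. -/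
def cost (yd : L2 Ω) (p : L2Mat Ω × H10 Ω) : ℝ :=
  ‖p.2.toL2 - yd‖ ^ 2 + form (symPart p.1) p.2 p.2.grad

/-- The admissible pairs `Ξ` of the original problem with majorant `B`. -/
def admissiblePairs (α β c : ℝ) (Q : Set (L2Mat Ω)) (B : L2Mat Ω) (f : StrongDual ℝ (H10 Ω)) :
    Set (L2Mat Ω × H10 Ω) :=
  {p | p.1 ∈ Ad α β c Q B ∧ p.2 ∈ D p.1 ∧
    ∀ v : H10 Ω, form (symPart p.1) p.2 v.grad + bracket p.1 p.2 v = f v}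

/-- The admissible pairs `Ξ_k` of a regularized problem, with bounded majorant `Bk`. -/
def regularizedPairs (α β c : ℝ) (Q : Set (L2Mat Ω)) (Bk : L2Mat Ω) (f : StrongDual ℝ (H10 Ω)) :
    Set (L2Mat Ω × H10 Ω) :=
  {p | p.1 ∈ Ad α β c Q Bk ∧ IsWeakSolution f p.1 p.2}

/-- `p` minimizes the cost on `X`. -/
def IsMinimizer (yd : L2 Ω) (X : Set (L2Mat Ω × H10 Ω)) (p : L2Mat Ω × H10 Ω) : Prop :=
  p ∈ X ∧ IsMinOn (cost yd) X p

/-- A pair as a point of `L²(Ω; 𝕄ᴺ) × H¹₀(Ω)` with the topology `τ`, the product of the strong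
topology and of the weak topology of `H¹₀(Ω)`. -/
def toTau (p : L2Mat Ω × H10 Ω) : L2Mat Ω × WeakSpace ℝ (H10 Ω) :=
  (p.1, toWeakSpace ℝ (H10 Ω) p.2)

end Problem

end EllipticControl

end

/-!
Only the skew part of a control can be unbounded, and it drops out of the energy: pairing a
solution for a bounded control with itself gives `∫ (∇y, Aˢʸᵐ ∇y) = f y`. With ellipticity and the
Poincaré inequality this yields existence and uniqueness (Lax–Milgram) and a bound for `‖y‖` that
is independent of the majorant `A*_k` (`existsUnique_isWeakSolution`,
`exists_norm_le_of_isWeakSolution`). It also turns the cost of a regularized pair into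
`‖y - y_d‖² + f y`, which is weakly lower semicontinuous.

Compactness of the controls reduces to the scalar statement that functions on `Ω` which are
bounded by `M` and have total variation at most `c` form a compact set in `L²(Ω)`
(`isCompact_boundedVariationBall`). No regularity of `∂Ω` is needed: on a compact `K ⊆ Ω` the
definition of the total variation by duality gives `∫_K |g(y + a) - g(y)| dy ≤ c |a|`, so averaging
with a density concentrated in a ball of radius `ε` moves `g` by at most `c ε` in `L¹(K)`. The
averages of a weakly convergent sequence converge, and the part `Ω \ K` is negligible
because of the bound `M`. All admissible controls then lie in the sum of a compact set of symmetric
parts and the compact set `Q`.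

Testing with a fixed `φ ∈ C_c^∞(Ω)`, the integral `∫ (∇φ, M ∇y)` is a bounded bilinear form in
`(M, ∇y) ∈ L² × L²`, because `∇φ` is bounded. Hence the weak formulation passes to limits under
strong convergence of the controls and weak convergence of the states (`isWeakSolution_of_tendsto`),
also when the limit control is unbounded. In the limit the identity says that `[y, φ]_A` equals a bounded
functional of `φ`, which gives `y ∈ D(A)` and `[y, v]_A = f v - ∫ (∇v, Aˢʸᵐ ∇y)`
(`mem_D_and_bracket_eq`). Finally `[y, y]_A = f y - ∫ (∇y, Aˢʸᵐ ∇y) ≥ 0` is the lower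
semicontinuity of the elliptic energy along the minimizers, whose energies are `f y_k`
(`form_symPart_self_le_of_tendsto`).
-/

namespace EllipticControl

noncomputable section

variable {N : ℕ} {Ω : Opens (Vec N)}

/-! ### Total variation and translations of smooth test functions -/

theorem divergence_smul_const {u : Vec N → ℝ} {x : Vec N} (hu : DifferentiableAt ℝ u x)
    (v : Vec N) : divergence (fun y => u y • v) x = fderiv ℝ u x v := by
  have hv : v = ∑ i, v i • EuclideanSpace.single i (1 : ℝ) := by
    simpa using ((EuclideanSpace.basisFun (Fin N) ℝ).sum_repr v).symm
  conv_rhs => rw [hv]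
  simp [divergence, fderiv_smul_const hu, map_sum, mul_comm]

theorem integral_mul_divergence_le_of_TV_le {g : Vec N → ℝ} {c : ℝ} (hc : 0 ≤ c)
    (h : TV Ω g ≤ ENNReal.ofReal c) (φ : 𝓓^{1}(Ω, Vec N)) (hφ : ∀ x, ‖φ x‖ ≤ 1) :
    ∫ x, g x * divergence φ x ∂leb Ω ≤ c := by
  rw [TV, iSup₂_le_iff] at h
  exact (ENNReal.ofReal_le_ofReal_iff hc).1 (h φ hφ)

theorem TV_le_of_forall {g : Vec N → ℝ} {c : ℝ}
    (h : ∀ φ : 𝓓^{1}(Ω, Vec N), (∀ x, ‖φ x‖ ≤ 1) → ∫ x, g x * divergence φ x ∂leb Ω ≤ c) :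
    TV Ω g ≤ ENNReal.ofReal c :=
  iSup₂_le fun φ hφ => ENNReal.ofReal_le_ofReal (h φ hφ)

/-- Differentiating a test function along a direction `v` with `‖v‖ ≤ 1` gives an admissible
divergence in the definition of the total variation. -/
theorem abs_integral_mul_fderiv_le {g : Vec N → ℝ} {c : ℝ} (hc : 0 ≤ c)
    (h : TV Ω g ≤ ENNReal.ofReal c) {u : Vec N → ℝ} (hu : ContDiff ℝ 1 u)
    (hcu : HasCompactSupport u) (hsu : tsupport u ⊆ Ω) (hu1 : ∀ x, |u x| ≤ 1) {v : Vec N}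
    (hv : ‖v‖ ≤ 1) : |∫ x, g x * fderiv ℝ u x v ∂leb Ω| ≤ c := by
  have key : ∀ w : Vec N, ‖w‖ ≤ 1 → ∫ x, g x * fderiv ℝ u x w ∂leb Ω ≤ c := by
    intro w hw
    let Φ : 𝓓^{1}(Ω, Vec N) := ⟨fun x => u x • w, hu.smul contDiff_const,
      hcu.smul_right, (tsupport_smul_subset_left u fun _ => w).trans hsu⟩
    have hΦ : ∀ x, ‖Φ x‖ ≤ 1 := fun x => by
      change ‖u x • w‖ ≤ 1
      rw [norm_smul, Real.norm_eq_abs]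
      exact mul_le_one₀ (hu1 x) (norm_nonneg _) hw
    have := integral_mul_divergence_le_of_TV_le hc h Φ hΦ
    have e : ∀ x, divergence Φ x = fderiv ℝ u x w := fun x =>
      divergence_smul_const (hu.differentiable (by simp) x) w
    simpa only [e] using this
  rw [abs_le]
  refine ⟨?_, key v hv⟩
  have := key (-v) (by simpa using hv)
  simp only [map_neg, mul_neg, integral_neg] at this
  linarith

/-- The derivative of `t ↦ ∫ g ψ(· - t v)` is an integral of `g` against a divergence, hence this
function is Lipschitz with the total variation as a constant. -/
theorem abs_integral_mul_sub_translate_le {g : Vec N → ℝ} (hg : Integrable g (leb Ω)) {c : ℝ}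
    (hc : 0 ≤ c) (h : TV Ω g ≤ ENNReal.ofReal c) {u : Vec N → ℝ} (hu : ContDiff ℝ 1 u)
    (hcu : HasCompactSupport u) (hu1 : ∀ x, |u x| ≤ 1) {v : Vec N} (hv : ‖v‖ ≤ 1) {τ : ℝ}
    (hτ : 0 ≤ τ) (hsu : ∀ t ∈ Set.Icc 0 τ, ∀ x ∈ tsupport u, x + t • v ∈ Ω) :
    |(∫ x, g x * u (x - τ • v) ∂leb Ω) - ∫ x, g x * u x ∂leb Ω| ≤ c * τ := by
  obtain ⟨C, hC⟩ : ∃ C, ∀ x, ‖fderiv ℝ u x‖ ≤ C :=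
    (hu.continuous_fderiv one_ne_zero).bounded_above_of_compact_support
      (hcu.fderiv (𝕜 := ℝ))
  have hcont : ∀ t : ℝ, Continuous fun x : Vec N => u (x - t • v) := fun t =>
    hu.continuous.comp (by fun_prop)
  have hint : ∀ t : ℝ, Integrable (fun x => g x * u (x - t • v)) (leb Ω) := fun t =>
    hg.mul_bdd (hcont t).aestronglyMeasurable (ae_of_all _ fun x => hu1 _)
  have hd : ∀ t : ℝ, HasDerivAt (fun t : ℝ => ∫ x, g x * u (x - t • v) ∂leb Ω)
      (∫ x, g x * -(fderiv ℝ u (x - t • v) v) ∂leb Ω) t := by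
    intro t
    refine (hasDerivAt_integral_of_dominated_loc_of_deriv_le (bound := fun x => ‖g x‖ * C)
      (F' := fun t x => g x * -(fderiv ℝ u (x - t • v) v))
      Filter.univ_mem (Eventually.of_forall fun t => (hint t).1) (hint t) ?_ ?_
      (hg.norm.mul_const C) ?_).2
    · refine hg.1.mul (Continuous.aestronglyMeasurable ?_)
      have := hu.continuous_fderiv one_ne_zero
      fun_prop
    · refine ae_of_all _ fun x t _ => ?_
      rw [norm_mul, norm_neg]
      gcongr
      refine ((fderiv ℝ u (x - t • v)).le_opNorm v).trans ?_
      exact (mul_le_of_le_one_right (norm_nonneg _) hv).trans (hC _)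
    · refine ae_of_all _ fun x t _ => ?_
      have h1 : HasDerivAt (fun t : ℝ => x - t • v) (-v) t := by
        simpa using ((hasDerivAt_id t).smul_const v).const_sub x
      have h2 := ((hu.differentiable one_ne_zero (x - t • v)).hasFDerivAt).comp_hasDerivAt t h1
      simpa using h2.const_mul (g x)
  have := Convex.norm_image_sub_le_of_norm_hasDerivWithin_le (s := Set.Icc 0 τ) (x := (0 : ℝ))
    (y := τ) (C := c) (fun t _ => (hd t).hasDerivWithinAt) ?_ (convex_Icc 0 τ) (by simp [hτ])
    (by simp [hτ])
  · simpa [abs_of_nonneg hτ] using this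
  · intro t ht
    have hsupp : tsupport (fun x => u (x - t • v)) ⊆ (fun x => x - t • v) ⁻¹' tsupport u :=
      tsupport_comp_subset_preimage u (by fun_prop)
    have := abs_integral_mul_fderiv_le hc h (u := fun x => u (x - t • v))
      (hu.comp (by fun_prop)) (hcu.comp_homeomorph (Homeomorph.subRight (t • v)))
      (fun x hx => by simpa using hsu t ht _ (hsupp hx)) (fun x => hu1 _) hv
    simpa [fderiv_comp_sub, integral_neg] using this

/-! ### Translation estimates in `L¹` -/

/-- Smoothing a measurable function with values in `[-1, 1]` that vanishes off a compact set. -/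
theorem exists_mollification {K : Set (Vec N)} (hK : IsCompact K) {s : Vec N → ℝ}
    (hs : Measurable s) (hs1 : ∀ x, |s x| ≤ 1) (hsK : ∀ x ∉ K, s x = 0) {δ : ℝ} (hδ : 0 < δ) :
    ∃ ψ : ℕ → Vec N → ℝ, (∀ n, ContDiff ℝ 1 (ψ n)) ∧ (∀ n, HasCompactSupport (ψ n)) ∧
      (∀ n x, |ψ n x| ≤ 1) ∧ (∀ n, tsupport (ψ n) ⊆ Metric.cthickening δ K) ∧
      ∀ᵐ x, Tendsto (fun n => ψ n x) atTop (𝓝 (s x)) := by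
  have hδn : ∀ n : ℕ, 0 < δ / (n + 1) := fun n => by positivity
  let φ : ℕ → ContDiffBump (0 : Vec N) := fun n =>
    ⟨δ / (n + 1) / 2, δ / (n + 1), half_pos (hδn n), half_lt_self (hδn n)⟩
  have hsint : Integrable s := by
    have h1 : Integrable (K.indicator fun _ => (1 : ℝ)) :=
      (integrable_indicator_iff hK.measurableSet).2 (integrableOn_const hK.measure_lt_top.ne)
    refine h1.mono' hs.aestronglyMeasurable (ae_of_all _ fun x => ?_)
    by_cases hx : x ∈ K
    · simpa [hx] using hs1 x
    · simp [hx, hsK x hx]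
  let ψ : ℕ → Vec N → ℝ := fun n =>
    convolution ((φ n).normed volume) s (ContinuousLinearMap.lsmul ℝ ℝ) volume
  have hsub : ∀ n, tsupport (ψ n) ⊆ Metric.cthickening δ K := by
    intro n
    refine closure_minimal (fun x hx => ?_) Metric.isClosed_cthickening
    obtain ⟨a, ha, b, hb, rfl⟩ := support_convolution_subset _ hx
    have hbK : b ∈ K := by_contra fun h => hb (hsK b h)
    refine Metric.mem_cthickening_of_dist_le _ b δ K hbK ?_
    rw [(φ n).support_normed_eq, mem_ball_zero_iff] at ha
    have h1 : δ / (n + 1) ≤ δ := div_le_self hδ.le (by linarith [n.cast_nonneg (α := ℝ)])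
    simpa using ha.le.trans h1
  refine ⟨ψ, fun n => ?_, fun n => ?_, fun n x => ?_, hsub, ?_⟩
  · exact (φ n).hasCompactSupport_normed.contDiff_convolution_left (n := 1) _
      (φ n).contDiff_normed hsint.locallyIntegrable
  · exact hK.cthickening.of_isClosed_subset (isClosed_tsupport _) (hsub n)
  · rw [← Real.norm_eq_abs, ← (φ n).integral_normed (μ := volume)]
    refine norm_integral_le_of_norm_le (φ n).integrable_normed (ae_of_all _ fun t => ?_)
    have h0 := (φ n).nonneg_normed (μ := volume) t
    simpa [abs_of_nonneg h0] using mul_le_of_le_one_right h0 (hs1 (x - t))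
  · refine ContDiffBump.ae_convolution_tendsto_right_of_locallyIntegrable (K := 2) ?_ ?_
      hsint.locallyIntegrable
    · exact tendsto_const_div_atTop_nhds_zero_nat δ |>.comp (tendsto_add_atTop_nat 1) |>.congr
        fun n => by simp [φ]
    · exact Eventually.of_forall fun n => by simp only [φ]; linarith

/-- The Lipschitz bound for translations extends from smooth to measurable test functions. -/
theorem abs_integral_mul_sub_translate_le_of_measurable {g : Vec N → ℝ}
    (hg : Integrable g (leb Ω)) {c : ℝ} (hc : 0 ≤ c) (h : TV Ω g ≤ ENNReal.ofReal c)
    {K : Set (Vec N)} (hK : IsCompact K) {r : ℝ} (hKr : Metric.cthickening r K ⊆ Ω)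
    {s : Vec N → ℝ} (hs : Measurable s) (hs1 : ∀ x, |s x| ≤ 1) (hsK : ∀ x ∉ K, s x = 0)
    {a : Vec N} (ha : ‖a‖ < r) :
    |(∫ x, g x * s (x - a) ∂leb Ω) - ∫ x, g x * s x ∂leb Ω| ≤ c * ‖a‖ := by
  obtain ⟨ψ, hψ, hcψ, hψ1, hsψ, hlim⟩ := exists_mollification hK hs hs1 hsK (sub_pos.2 ha)
  -- The mollifications have support in the `(r - ‖a‖)`-neighbourhood of `K`, which stays in `Ω`
  -- when it is moved along the segment from `0` to `a`.
  have hlim' : ∀ᵐ x, Tendsto (fun n => ψ n (x - a)) atTop (𝓝 (s (x - a))) :=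
    (measurePreserving_sub_right volume a).quasiMeasurePreserving.ae hlim
  have L : ∀ b : Vec N, (∀ᵐ x, Tendsto (fun n => ψ n (x - b)) atTop (𝓝 (s (x - b)))) →
      Tendsto (fun n => ∫ x, g x * ψ n (x - b) ∂leb Ω) atTop
        (𝓝 (∫ x, g x * s (x - b) ∂leb Ω)) := by
    intro b hb
    refine tendsto_integral_of_dominated_convergence (fun x => ‖g x‖) (fun n => ?_) hg.norm
      (fun n => ae_of_all _ fun x => ?_) ?_
    · exact hg.1.mul ((hψ n).continuous.comp (by fun_prop)).aestronglyMeasurable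
    · rw [norm_mul]
      exact mul_le_of_le_one_right (norm_nonneg _) (hψ1 n _)
    · filter_upwards [ae_restrict_of_ae hb] with x hx using hx.const_mul _
  have L0 := L 0 (by simpa using hlim)
  simp only [sub_zero] at L0
  refine le_of_tendsto ((L a hlim').sub L0).abs (Eventually.of_forall fun n => ?_)
  have hva : ‖a‖ • (‖a‖⁻¹ • a) = a := by
    rcases eq_or_ne a 0 with rfl | h0
    · simp
    · rw [smul_smul, mul_inv_cancel₀ (norm_ne_zero_iff.2 h0), one_smul]
  have hv1 : ‖‖a‖⁻¹ • a‖ ≤ 1 := by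
    rw [norm_smul, norm_inv, norm_norm]
    exact inv_mul_le_one
  have := abs_integral_mul_sub_translate_le hg hc h (hψ n) (hcψ n) (hψ1 n) hv1
    (norm_nonneg a) (fun t ht x hx => hKr ?_)
  · rwa [hva] at this
  · have h1 : x + t • (‖a‖⁻¹ • a) ∈ Metric.cthickening ‖a‖ (Metric.cthickening (r - ‖a‖) K) := by
      refine Metric.mem_cthickening_of_dist_le _ x _ _ (hsψ n hx) ?_
      rw [dist_self_add_left, norm_smul, Real.norm_eq_abs, abs_of_nonneg ht.1]
      exact (mul_le_of_le_one_right ht.1 hv1).trans ht.2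
    have h2 := Metric.cthickening_cthickening_subset (norm_nonneg a) (sub_pos.2 ha).le K h1
    rwa [add_sub_cancel] at h2

/-- Translation estimate in `L¹` for a bounded function of finite total variation. -/
theorem setIntegral_abs_translate_sub_le (hΩ : Bornology.IsBounded (Ω : Set (Vec N)))
    {g : Vec N → ℝ} (hgm : Measurable g)
    {M : ℝ} (hM : ∀ x, |g x| ≤ M) {c : ℝ} (hc : 0 ≤ c) (h : TV Ω g ≤ ENNReal.ofReal c)
    {K : Set (Vec N)} (hK : IsCompact K) {r : ℝ} (hKr : Metric.cthickening r K ⊆ Ω)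
    {a : Vec N} (ha : ‖a‖ < r) :
    ∫ y in K, |(Ω : Set (Vec N)).indicator g (y + a) - (Ω : Set (Vec N)).indicator g y|
      ≤ c * ‖a‖ := by
  have : IsFiniteMeasure (leb Ω) := ⟨by simpa using hΩ.measure_lt_top⟩
  have hg : Integrable g (leb Ω) := Integrable.of_bound hgm.aestronglyMeasurable M (ae_of_all _ hM)
  have hΩm : MeasurableSet (Ω : Set (Vec N)) := Ω.isOpen.measurableSet
  set G := (Ω : Set (Vec N)).indicator g with hG
  have hGm : Measurable G := hgm.indicator hΩm
  have hGi : Integrable G := (integrable_indicator_iff hΩm).2 hg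
  -- Testing with the sign of the difference turns the dual bound into an `L¹` bound.
  let s : Vec N → ℝ := K.indicator fun y => if 0 ≤ G (y + a) - G y then 1 else -1
  have hs : Measurable s := by
    refine Measurable.indicator (Measurable.ite ?_ measurable_const measurable_const)
      hK.measurableSet
    exact measurableSet_le measurable_const
      ((hGm.comp (measurable_id.add_const a)).sub hGm)
  have hs1 : ∀ x, |s x| ≤ 1 := fun x => by
    by_cases hx : x ∈ K
    · simp only [s, Set.indicator_of_mem hx]; split_ifs <;> simp
    · simp [s, hx]
  have key := abs_integral_mul_sub_translate_le_of_measurable hg hc h hK hKr hs hs1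
    (fun x hx => Set.indicator_of_notMem hx _) ha
  have conv : ∀ u : Vec N → ℝ, ∫ x, g x * u x ∂leb Ω = ∫ x, G x * u x := fun u => by
    rw [← integral_indicator hΩm]
    refine integral_congr_ae (ae_of_all _ fun x => ?_)
    by_cases hx : x ∈ (Ω : Set (Vec N)) <;> simp [hG, hx]
  rw [conv, conv, ← integral_add_right_eq_self (fun x => G x * s (x - a)) a,
    ← integral_sub] at key
  · refine le_trans (le_of_eq ?_) ((le_abs_self _).trans key)
    rw [← integral_indicator hK.measurableSet]
    refine integral_congr_ae (ae_of_all _ fun x => ?_)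
    by_cases hx : x ∈ K
    · simp only [s, Set.indicator_of_mem hx, add_sub_cancel_right]
      split_ifs with h0
      · rw [abs_of_nonneg h0]; ring
      · rw [abs_of_neg (not_le.1 h0)]; ring
    · simp [s, hx]
  · simp only [add_sub_cancel_right]
    exact (hGi.comp_add_right a).mul_bdd hs.aestronglyMeasurable (ae_of_all _ hs1)
  · exact hGi.mul_bdd hs.aestronglyMeasurable (ae_of_all _ hs1)

/-! ### Averages of functions of bounded variation -/

theorem TV_congr {g g' : Vec N → ℝ} (h : g =ᵐ[leb Ω] g') : TV Ω g = TV Ω g' := by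
  refine iSup_congr fun φ => iSup_congr fun _ => ?_
  congr 1
  exact integral_congr_ae (h.mono fun x hx => by simp only [hx])

theorem isFiniteMeasure_leb (hΩ : Bornology.IsBounded (Ω : Set (Vec N))) :
    IsFiniteMeasure (leb Ω) :=
  ⟨by simpa using hΩ.measure_lt_top⟩

/-- Averaging a bounded function of bounded variation with a probability density concentrated in
the ball of radius `ε` changes it by `O(ε)` in `L¹(K)`. -/
theorem setIntegral_abs_average_sub_le (hΩ : Bornology.IsBounded (Ω : Set (Vec N)))
    {g : Vec N → ℝ} (hgm : Measurable g)
    {M : ℝ} (hM : ∀ x, |g x| ≤ M) {c : ℝ} (hc : 0 ≤ c) (h : TV Ω g ≤ ENNReal.ofReal c)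
    {K : Set (Vec N)} (hK : IsCompact K) {r : ℝ} (hKr : Metric.cthickening r K ⊆ Ω)
    {κ : Vec N → ℝ} (hκm : Measurable κ) (hκ0 : ∀ x, 0 ≤ κ x) (hκi : Integrable κ)
    (hκ1 : ∫ x, κ x = 1) {ε : ℝ} (hεr : ε ≤ r) (hκε : ∀ x, ε ≤ ‖x‖ → κ x = 0) :
    ∫ y in K, |(∫ x, g x * κ (x - y) ∂leb Ω) - g y| ≤ c * ε := by
  have hΩm : MeasurableSet (Ω : Set (Vec N)) := Ω.isOpen.measurableSet
  have hM0 : 0 ≤ M := (abs_nonneg _).trans (hM 0)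
  have : IsFiniteMeasure (volume.restrict K) := ⟨by simpa using hK.measure_lt_top⟩
  set G := (Ω : Set (Vec N)).indicator g with hG
  have hGm : Measurable G := hgm.indicator hΩm
  have hGM : ∀ x, |G x| ≤ M := fun x => by
    by_cases hx : x ∈ (Ω : Set (Vec N))
    · simpa [hG, hx] using hM x
    · simpa [hG, hx] using hM0
  have hKΩ : K ⊆ Ω := (Metric.self_subset_cthickening K).trans hKr
  let F : Vec N → Vec N → ℝ := fun y a => κ a * |G (y + a) - G y|
  have hFm : Measurable (Function.uncurry F) := by
    refine (hκm.comp measurable_snd).mul (Measurable.abs ?_)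
    exact (hGm.comp (measurable_fst.add measurable_snd)).sub (hGm.comp measurable_fst)
  have hF0 : ∀ y a, 0 ≤ F y a := fun y a => mul_nonneg (hκ0 a) (abs_nonneg _)
  have hG2 : ∀ y a, |G (y + a) - G y| ≤ 2 * M := fun y a =>
    (abs_sub _ _).trans (by linarith [hGM (y + a), hGM y])
  have hFi : Integrable (Function.uncurry F) ((volume.restrict K).prod volume) := by
    have h1 : Integrable (fun p : Vec N × Vec N => (2 * M) * κ p.2)
        ((volume.restrict K).prod volume) :=
      (Integrable.mul_prod (integrable_const (2 * M) : Integrable (fun _ : Vec N => 2 * M)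
        (volume.restrict K)) hκi)
    refine h1.mono' hFm.aestronglyMeasurable (ae_of_all _ fun p => ?_)
    change |F p.1 p.2| ≤ _
    rw [abs_of_nonneg (hF0 p.1 p.2), mul_comm]
    exact mul_le_mul_of_nonneg_left (hG2 _ _) (hκ0 _)
  have hpt : ∀ y ∈ K, |(∫ x, g x * κ (x - y) ∂leb Ω) - g y| ≤ ∫ a, F y a := by
    intro y hy
    have e1 : ∫ x, g x * κ (x - y) ∂leb Ω = ∫ a, κ a * G (y + a) := by
      rw [← integral_indicator hΩm,
        ← integral_add_right_eq_self (fun x => (Ω : Set (Vec N)).indicator _ x) y]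
      refine integral_congr_ae (ae_of_all _ fun a => ?_)
      by_cases hx : a + y ∈ (Ω : Set (Vec N))
      · simp [hG, hx, add_comm y a, mul_comm]
      · simp [hG, hx, add_comm y a]
    have e2 : g y = ∫ a, κ a * G y := by
      rw [integral_mul_const, hκ1, one_mul, hG, Set.indicator_of_mem (hKΩ hy)]
    have i1 : Integrable fun a => κ a * G (y + a) :=
      hκi.mul_bdd (hGm.comp (measurable_const_add y)).aestronglyMeasurable
        (ae_of_all _ fun a => hGM _)
    rw [e1, e2, ← integral_sub i1 (hκi.mul_const _)]
    refine (abs_integral_le_integral_abs).trans (le_of_eq ?_)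
    refine integral_congr_ae (ae_of_all _ fun a => ?_)
    simp only [F]
    rw [← mul_sub, abs_mul, abs_of_nonneg (hκ0 a)]
  calc ∫ y in K, |(∫ x, g x * κ (x - y) ∂leb Ω) - g y|
      ≤ ∫ y in K, ∫ a, F y a := by
        refine integral_mono_of_nonneg (ae_of_all _ fun y => abs_nonneg _)
          hFi.integral_prod_left ?_
        exact (ae_restrict_iff' hK.measurableSet).2 (ae_of_all _ hpt)
    _ = ∫ a, ∫ y in K, F y a := integral_integral_swap hFi
    _ ≤ ∫ a, κ a * (c * ε) := by
        refine integral_mono_of_nonneg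
          (ae_of_all _ fun a => integral_nonneg fun y => hF0 y a) (hκi.mul_const _)
          (ae_of_all _ fun a => ?_)
        simp only [F]
        rw [integral_const_mul]
        by_cases ha : ε ≤ ‖a‖
        · simp [hκε a ha]
        · refine mul_le_mul_of_nonneg_left ?_ (hκ0 a)
          refine (setIntegral_abs_translate_sub_le hΩ hgm hM hc h hK hKr
            ((not_le.1 ha).trans_le hεr)).trans ?_
          exact mul_le_mul_of_nonneg_left (not_le.1 ha).le hc
    _ = c * ε := by rw [integral_mul_const, hκ1, one_mul]

/-- The functions on `Ω` bounded by `M` whose total variation is at most `c`. -/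
def boundedVariationBall (Ω : Opens (Vec N)) (M c : ℝ) : Set (L2 Ω) :=
  {g | (∀ᵐ x ∂leb Ω, |g x| ≤ M) ∧ TV Ω g ≤ ENNReal.ofReal c}

theorem setIntegral_abs_average_sub_le_of_mem (hΩ : Bornology.IsBounded (Ω : Set (Vec N)))
    {M c : ℝ} (hM : 0 ≤ M) (hc : 0 ≤ c) {g : L2 Ω} (hg : g ∈ boundedVariationBall Ω M c)
    {K : Set (Vec N)} (hK : IsCompact K) {r : ℝ} (hKr : Metric.cthickening r K ⊆ Ω)
    {κ : Vec N → ℝ} (hκm : Measurable κ) (hκ0 : ∀ x, 0 ≤ κ x) (hκi : Integrable κ)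
    (hκ1 : ∫ x, κ x = 1) {ε : ℝ} (hεr : ε ≤ r) (hκε : ∀ x, ε ≤ ‖x‖ → κ x = 0) :
    ∫ y in K, |(∫ x, g x * κ (x - y) ∂leb Ω) - g y| ∂leb Ω ≤ c * ε := by
  -- Truncation produces a representative that is bounded everywhere.
  let g' : Vec N → ℝ := fun x => max (-M) (min (g x) M)
  have hgm : Measurable g := (Lp.stronglyMeasurable g).measurable
  have hg'm : Measurable g' := measurable_const.max (hgm.min measurable_const)
  have hg' : g =ᵐ[leb Ω] g' := by
    filter_upwards [hg.1] with x hx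
    rw [abs_le] at hx
    simp [g', hx.1, hx.2]
  have hb : ∀ x, |g' x| ≤ M := fun x => by
    rw [abs_le]
    exact ⟨le_max_left _ _, max_le (by linarith) (min_le_right _ _)⟩
  have := setIntegral_abs_average_sub_le hΩ hg'm hb hc (TV_congr hg' ▸ hg.2) hK hKr hκm hκ0 hκi
    hκ1 hεr hκε
  have hKΩ : K ⊆ Ω := (Metric.self_subset_cthickening K).trans hKr
  have e : (leb Ω).restrict K = volume.restrict K := Measure.restrict_restrict_of_subset hKΩ
  rw [← e] at this
  refine le_trans (le_of_eq ?_) this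
  refine integral_congr_ae ((ae_restrict_of_ae hg').mono fun y hy => ?_)
  simp only [hy]
  congr 2
  exact integral_congr_ae (hg'.mono fun x hx => by simp only [hx])

/-- Weak sequential compactness of balls in a separable Hilbert space. -/
theorem exists_subseq_tendsto_inner {H : Type*} [NormedAddCommGroup H] [InnerProductSpace ℝ H]
    [CompleteSpace H] [SeparableSpace H] {u : ℕ → H} {R : ℝ} (hu : ∀ n, ‖u n‖ ≤ R) :
    ∃ (g : H) (φ : ℕ → ℕ), StrictMono φ ∧
      ∀ w, Tendsto (fun n => inner ℝ (u (φ n)) w) atTop (𝓝 (inner ℝ g w)) := by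
  let T : H → WeakDual ℝ H := fun x => StrongDual.toWeakDual (InnerProductSpace.toDual ℝ H x)
  obtain ⟨F, -, φ, hφ, hF⟩ := WeakDual.isSeqCompact_closedBall ℝ H 0 R
    (x := fun n => T (u n)) fun n => by
      simpa [T, StrongDual.toStrongDual_toWeakDual] using hu n
  refine ⟨(InnerProductSpace.toDual ℝ H).symm (WeakDual.toStrongDual F), φ, hφ, fun w => ?_⟩
  have := ((WeakDual.eval_continuous w).tendsto F).comp hF
  simpa [T, Function.comp_def] using this

/-! ### From weak to strong convergence -/

theorem abs_sub_le_of_ae_abs_le {M : ℝ} {g g' : L2 Ω} (hg : ∀ᵐ x ∂leb Ω, |g x| ≤ M)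
    (hg' : ∀ᵐ x ∂leb Ω, |g' x| ≤ M) : ∀ᵐ x ∂leb Ω, |g x - g' x| ≤ 2 * M := by
  filter_upwards [hg, hg'] with x h1 h2
  exact (abs_sub _ _).trans (by linarith)

/-- For bounded functions, `L¹` closeness on a large part of `Ω` gives `L²` closeness. -/
theorem norm_sub_sq_le_of_setIntegral (hΩ : Bornology.IsBounded (Ω : Set (Vec N)))
    {M : ℝ} (hM : 0 ≤ M) {g g' : L2 Ω} (hg : ∀ᵐ x ∂leb Ω, |g x| ≤ M)
    (hg' : ∀ᵐ x ∂leb Ω, |g' x| ≤ M) {K : Set (Vec N)} (hK : MeasurableSet K) :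
    ‖g - g'‖ ^ 2 ≤
      2 * M * (∫ x in K, |g x - g' x| ∂leb Ω + 2 * M * (leb Ω).real Kᶜ) := by
  have := isFiniteMeasure_leb hΩ
  have hb := abs_sub_le_of_ae_abs_le hg hg'
  have hi : Integrable (fun x => |g x - g' x|) (leb Ω) :=
    (((Lp.memLp g).integrable (by norm_num)).sub ((Lp.memLp g').integrable (by norm_num))).abs
  calc ‖g - g'‖ ^ 2 = ∫ x, (g - g' : L2 Ω) x * (g - g' : L2 Ω) x ∂leb Ω := by
        rw [← real_inner_self_eq_norm_sq, L2.inner_def]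
        refine integral_congr_ae (ae_of_all _ fun x => ?_)
        simp only [RCLike.inner_apply, conj_trivial]
    _ ≤ ∫ x, 2 * M * |g x - g' x| ∂leb Ω := by
        refine integral_mono_of_nonneg (ae_of_all _ fun x => mul_self_nonneg _)
          (hi.const_mul _) ?_
        filter_upwards [Lp.coeFn_sub g g', hb] with x hx hx'
        rw [hx, Pi.sub_apply, ← abs_mul_abs_self]
        exact mul_le_mul_of_nonneg_right hx' (abs_nonneg _)
    _ = 2 * M * (∫ x in K, |g x - g' x| ∂leb Ω + ∫ x in Kᶜ, |g x - g' x| ∂leb Ω) := by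
        rw [integral_const_mul, integral_add_compl hK hi]
    _ ≤ _ := by
        gcongr
        refine (integral_mono_of_nonneg (g := fun _ => 2 * M)
          (ae_of_all _ fun x => abs_nonneg _) (integrable_const _)
          (ae_restrict_of_ae hb)).trans (le_of_eq ?_)
        simp [mul_comm]

theorem measurable_average (g : L2 Ω) {κ : Vec N → ℝ} (hκ : Measurable κ) :
    Measurable fun y => ∫ x, g x * κ (x - y) ∂leb Ω := by
  refine (StronglyMeasurable.integral_prod_right (f := fun y x => g x * κ (x - y)) ?_).measurable
  refine Measurable.stronglyMeasurable ?_
  exact ((Lp.stronglyMeasurable g).measurable.comp measurable_snd).mul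
    (hκ.comp (measurable_snd.sub measurable_fst))

theorem abs_average_le {M : ℝ} {g : L2 Ω} (hg : ∀ᵐ x ∂leb Ω, |g x| ≤ M)
    {κ : Vec N → ℝ} (hκ0 : ∀ x, 0 ≤ κ x) (hκi : Integrable κ)
    (hκ1 : ∫ x, κ x = 1) (hM : 0 ≤ M) (y : Vec N) :
    |∫ x, g x * κ (x - y) ∂leb Ω| ≤ M := by
  have hi : Integrable fun x => M * κ (x - y) := (hκi.comp_sub_right y).const_mul M
  calc |∫ x, g x * κ (x - y) ∂leb Ω| ≤ ∫ x, M * κ (x - y) ∂leb Ω := by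
        rw [← Real.norm_eq_abs]
        refine norm_integral_le_of_norm_le hi.integrableOn (hg.mono fun x hx => ?_)
        rw [norm_mul, Real.norm_eq_abs, Real.norm_eq_abs, abs_of_nonneg (hκ0 _)]
        exact mul_le_mul_of_nonneg_right hx (hκ0 _)
    _ ≤ ∫ x, M * κ (x - y) :=
        setIntegral_le_integral hi (ae_of_all _ fun x => mul_nonneg hM (hκ0 _))
    _ = M := by
        rw [integral_const_mul, integral_sub_right_eq_self (fun x => κ x) y, hκ1, mul_one]

theorem tendsto_average {u : ℕ → L2 Ω} {g : L2 Ω}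
    (hw : ∀ w : L2 Ω, Tendsto (fun n => inner ℝ (u n) w) atTop (𝓝 (inner ℝ g w)))
    {κ : Vec N → ℝ} (hκ : Continuous κ) (hκc : HasCompactSupport κ) (y : Vec N) :
    Tendsto (fun n => ∫ x, u n x * κ (x - y) ∂leb Ω) atTop
      (𝓝 (∫ x, g x * κ (x - y) ∂leb Ω)) := by
  have hL : MemLp (fun x => κ (x - y)) 2 (leb Ω) :=
    Continuous.memLp_of_hasCompactSupport (by fun_prop)
      (hκc.comp_homeomorph (Homeomorph.subRight y))
  have e : ∀ w : L2 Ω, inner ℝ w (hL.toLp _) = ∫ x, w x * κ (x - y) ∂leb Ω := by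
    intro w
    rw [L2.inner_def]
    refine integral_congr_ae (hL.coeFn_toLp.mono fun x hx => ?_)
    simp [hx, mul_comm]
  simpa only [e] using hw (hL.toLp _)

theorem abs_average_le_of_tendsto {M : ℝ} (hM : 0 ≤ M) {u : ℕ → L2 Ω}
    (hu : ∀ n, ∀ᵐ x ∂leb Ω, |u n x| ≤ M) {g : L2 Ω}
    (hw : ∀ w : L2 Ω, Tendsto (fun n => inner ℝ (u n) w) atTop (𝓝 (inner ℝ g w)))
    {κ : Vec N → ℝ} (hκ : Continuous κ) (hκc : HasCompactSupport κ) (hκ0 : ∀ x, 0 ≤ κ x)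
    (hκ1 : ∫ x, κ x = 1) (y : Vec N) : |∫ x, g x * κ (x - y) ∂leb Ω| ≤ M :=
  le_of_tendsto (tendsto_average hw hκ hκc y).abs (Eventually.of_forall fun n =>
    abs_average_le (hu n) hκ0 (hκ.integrable_of_hasCompactSupport hκc) hκ1 hM y)

/-- Averages with a bounded kernel converge in `L¹` along a bounded weakly convergent sequence. -/
theorem tendsto_setIntegral_abs_average_sub (hΩ : Bornology.IsBounded (Ω : Set (Vec N)))
    {M : ℝ} (hM : 0 ≤ M) {u : ℕ → L2 Ω} (hu : ∀ n, ∀ᵐ x ∂leb Ω, |u n x| ≤ M) {g : L2 Ω}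
    (hw : ∀ w : L2 Ω, Tendsto (fun n => inner ℝ (u n) w) atTop (𝓝 (inner ℝ g w)))
    {κ : Vec N → ℝ} (hκ : Continuous κ) (hκc : HasCompactSupport κ) (hκ0 : ∀ x, 0 ≤ κ x)
    (hκ1 : ∫ x, κ x = 1) (K : Set (Vec N)) :
    Tendsto (fun n => ∫ y in K, |(∫ x, u n x * κ (x - y) ∂leb Ω) -
      ∫ x, g x * κ (x - y) ∂leb Ω| ∂leb Ω) atTop (𝓝 0) := by
  have := isFiniteMeasure_leb hΩ
  have hκi : Integrable κ := hκ.integrable_of_hasCompactSupport hκc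
  have hlim := tendsto_average hw hκ hκc
  have hbd : ∀ n y, |∫ x, u n x * κ (x - y) ∂leb Ω| ≤ M := fun n y =>
    abs_average_le (hu n) hκ0 hκi hκ1 hM y
  have hbd' := abs_average_le_of_tendsto hM hu hw hκ hκc hκ0 hκ1
  rw [← integral_zero (Vec N) ℝ (μ := (leb Ω).restrict K)]
  refine tendsto_integral_of_dominated_convergence (fun _ => 2 * M) (fun n => ?_)
    (integrable_const _) (fun n => ae_of_all _ fun y => ?_) (ae_of_all _ fun y => ?_)
  · exact ((measurable_average (u n) hκ.measurable).sub
      (measurable_average g hκ.measurable)).abs.aestronglyMeasurable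
  · rw [Real.norm_eq_abs, abs_abs]
    exact (abs_sub _ _).trans (by linarith [hbd n y, hbd' y])
  · simpa using ((hlim y).sub_const (∫ x, g x * κ (x - y) ∂leb Ω)).abs

/-- A weakly convergent sequence of bounded functions of bounded total variation is a Cauchy
sequence in `L²`. -/
theorem cauchySeq_of_tendsto_inner (hΩ : Bornology.IsBounded (Ω : Set (Vec N))) {M c : ℝ}
    (hM : 0 ≤ M) (hc : 0 ≤ c) {u : ℕ → L2 Ω} (hu : ∀ n, u n ∈ boundedVariationBall Ω M c)
    {g : L2 Ω} (hw : ∀ w : L2 Ω, Tendsto (fun n => inner ℝ (u n) w) atTop (𝓝 (inner ℝ g w))) :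
    CauchySeq u := by
  have := isFiniteMeasure_leb hΩ
  have key : ∀ δ > 0, ∃ n₀, ∀ m ≥ n₀, ∀ n ≥ n₀,
      ‖u m - u n‖ ^ 2 ≤ 2 * M * (2 * c + 2 + 2 * M) * δ := by
    intro δ hδ
    obtain ⟨K, hKΩ, hK, hKδ⟩ := Ω.isOpen.measurableSet.exists_isCompact_sdiff_lt
      (μ := volume) hΩ.measure_lt_top.ne (ε := ENNReal.ofReal δ) (by simpa using hδ)
    obtain ⟨r, hr, hKr⟩ := hK.exists_cthickening_subset_open Ω.isOpen hKΩ
    have hKδ' : (leb Ω).real Kᶜ ≤ δ := by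
      refine ENNReal.toReal_le_of_le_ofReal hδ.le ?_
      rw [Measure.restrict_apply hK.measurableSet.compl, Set.inter_comm, ← Set.sdiff_eq]
      exact hKδ.le
    set ε := min r δ with hε
    have hε0 : 0 < ε := lt_min hr hδ
    let φ : ContDiffBump (0 : Vec N) := ⟨ε / 2, ε, half_pos hε0, half_lt_self hε0⟩
    let κ := φ.normed volume
    have hκ : Continuous κ := φ.continuous_normed
    have hκc : HasCompactSupport κ := φ.hasCompactSupport_normed
    have hκ0 : ∀ x, 0 ≤ κ x := φ.nonneg_normed
    have hκ1 : ∫ x, κ x = 1 := φ.integral_normed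
    have hκε : ∀ x, ε ≤ ‖x‖ → κ x = 0 := fun x hx => by
      by_contra h
      have : x ∈ Function.support κ := h
      rw [φ.support_normed_eq, mem_ball_zero_iff] at this
      exact absurd this (not_lt.2 hx)
    have hest := fun n => setIntegral_abs_average_sub_le_of_mem hΩ hM hc (hu n) hK hKr
      hκ.measurable hκ0 (hκ.integrable_of_hasCompactSupport hκc) hκ1 (min_le_left r δ) hκε
    have hlim := tendsto_setIntegral_abs_average_sub hΩ hM (fun n => (hu n).1) hw hκ hκc hκ0 hκ1 K
    obtain ⟨n₀, hn₀⟩ := eventually_atTop.1 (hlim.eventually_le_const hδ)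
    refine ⟨n₀, fun m hm n hn => ?_⟩
    refine (norm_sub_sq_le_of_setIntegral hΩ hM (hu m).1 (hu n).1 hK.measurableSet).trans ?_
    let a : ℕ → Vec N → ℝ := fun n y => ∫ x, u n x * κ (x - y) ∂leb Ω
    let b : Vec N → ℝ := fun y => ∫ x, g x * κ (x - y) ∂leb Ω
    have ia : ∀ n, Integrable (fun y => |a n y - u n y|) ((leb Ω).restrict K) := fun n => by
      refine Integrable.of_bound (C := M + M) ?_ ?_
      · exact ((measurable_average (u n) hκ.measurable).sub
          (Lp.stronglyMeasurable (u n)).measurable).abs.aestronglyMeasurable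
      · refine ae_restrict_of_ae ((hu n).1.mono fun y hy => ?_)
        rw [Real.norm_eq_abs, abs_abs]
        exact (abs_sub _ _).trans (add_le_add (abs_average_le (hu n).1 hκ0
          (hκ.integrable_of_hasCompactSupport hκc) hκ1 hM y) hy)
    have ib : ∀ n, Integrable (fun y => |a n y - b y|) ((leb Ω).restrict K) := fun n => by
      refine Integrable.of_bound (C := M + M) ?_ (ae_of_all _ fun y => ?_)
      · exact ((measurable_average (u n) hκ.measurable).sub
          (measurable_average g hκ.measurable)).abs.aestronglyMeasurable
      · rw [Real.norm_eq_abs, abs_abs]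
        exact (abs_sub _ _).trans (add_le_add (abs_average_le (hu n).1 hκ0
          (hκ.integrable_of_hasCompactSupport hκc) hκ1 hM y)
          (abs_average_le_of_tendsto hM (fun n => (hu n).1) hw hκ hκc hκ0 hκ1 y))
    -- Compare `u m` and `u n` with their averages, and these with the average of the weak limit.
    have h3 : ∫ y in K, |u m y - u n y| ∂leb Ω ≤ 2 * c * ε + 2 * δ := by
      calc ∫ y in K, |u m y - u n y| ∂leb Ω
          ≤ ∫ y in K, ((|a m y - u m y| + |a n y - u n y|) + (|a m y - b y| + |a n y - b y|))
              ∂leb Ω := by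
            refine integral_mono_of_nonneg (ae_of_all _ fun y => abs_nonneg _)
              (((ia m).add (ia n)).add ((ib m).add (ib n))) (ae_of_all _ fun y => ?_)
            have : u m y - u n y =
              -(a m y - u m y) + (a n y - u n y) + ((a m y - b y) - (a n y - b y)) := by ring
            simp only [this]
            refine (abs_add_le _ _).trans (add_le_add ?_ (abs_sub _ _))
            exact (abs_add_le _ _).trans (by rw [abs_neg])
        _ ≤ (c * ε + c * ε) + (δ + δ) := by
            rw [integral_add (by exact (ia m).add (ia n)) (by exact (ib m).add (ib n)),
              integral_add (ia m) (ia n), integral_add (ib m) (ib n)]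
            exact add_le_add (add_le_add (hest m) (hest n)) (add_le_add (hn₀ m hm) (hn₀ n hn))
        _ = 2 * c * ε + 2 * δ := by ring
    have hεδ : ε ≤ δ := min_le_right _ _
    calc 2 * M * (∫ x in K, |u m x - u n x| ∂leb Ω + 2 * M * (leb Ω).real Kᶜ)
        ≤ 2 * M * ((2 * c * δ + 2 * δ) + 2 * M * δ) := by
          have := h3.trans (add_le_add_left (mul_le_mul_of_nonneg_left hεδ
            (mul_nonneg zero_le_two hc)) _)
          gcongr
      _ = _ := by ring
  refine Metric.cauchySeq_iff.2 fun η hη => ?_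
  set C := 2 * M * (2 * c + 2 + 2 * M) with hC
  have hC0 : 0 ≤ C := by positivity
  obtain ⟨n₀, hn₀⟩ := key (η ^ 2 / (2 * (C + 1))) (by positivity)
  refine ⟨n₀, fun m hm n hn => ?_⟩
  rw [dist_eq_norm]
  refine lt_of_pow_lt_pow_left₀ 2 hη.le ((hn₀ m hm n hn).trans_lt ?_)
  have : C * (η ^ 2 / (2 * (C + 1))) = η ^ 2 * (C / (2 * (C + 1))) := by ring
  rw [this]
  refine mul_lt_of_lt_one_right (by positivity) ?_
  rw [div_lt_one (by positivity)]
  linarith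

/-! ### Compactness of bounded functions of bounded variation -/

/-- Pointwise almost everywhere closed conditions are closed in `L²`: a convergent sequence has a
subsequence converging almost everywhere. -/
theorem isClosed_setOf_ae_mem_prod {X E F : Type*} [MeasurableSpace X] {μ : Measure X}
    [NormedAddCommGroup E] [NormedAddCommGroup F] {C : X → Set (E × F)}
    (hC : ∀ x, IsClosed (C x)) :
    IsClosed {p : Lp E 2 μ × Lp F 2 μ | ∀ᵐ x ∂μ, (p.1 x, p.2 x) ∈ C x} := by
  refine isSeqClosed_iff_isClosed.1 fun u p hu hup => ?_
  obtain ⟨n₁, hn₁, h₁⟩ := (tendstoInMeasure_of_tendsto_Lp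
    ((continuous_fst.tendsto p).comp hup)).exists_seq_tendsto_ae
  obtain ⟨n₂, hn₂, h₂⟩ := (tendstoInMeasure_of_tendsto_Lp
    (((continuous_snd.tendsto p).comp hup).comp hn₁.tendsto_atTop)).exists_seq_tendsto_ae
  have hall : ∀ᵐ x ∂μ, ∀ n, ((u n).1 x, (u n).2 x) ∈ C x := ae_all_iff.2 hu
  filter_upwards [h₁, h₂, hall] with x hx₁ hx₂ hx
  exact (hC x).mem_of_tendsto ((hx₁.comp hn₂.tendsto_atTop).prodMk_nhds hx₂)
    (Eventually.of_forall fun k => hx (n₁ (n₂ k)))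

theorem isClosed_setOf_ae_mem {X E : Type*} [MeasurableSpace X] {μ : Measure X}
    [NormedAddCommGroup E] {C : X → Set E} (hC : ∀ x, IsClosed (C x)) :
    IsClosed {f : Lp E 2 μ | ∀ᵐ x ∂μ, f x ∈ C x} :=
  (isClosed_setOf_ae_mem_prod (μ := μ) (C := fun x => Prod.fst ⁻¹' C x)
    fun x => (hC x).preimage continuous_fst).preimage (Continuous.prodMk_left (0 : Lp E 2 μ))

theorem continuous_divergence (φ : 𝓓^{1}(Ω, Vec N)) : Continuous (divergence φ) := by
  have h := φ.contDiff.continuous_fderiv (by simp)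
  unfold divergence
  fun_prop

theorem hasCompactSupport_divergence (φ : 𝓓^{1}(Ω, Vec N)) :
    HasCompactSupport (divergence φ) :=
  (φ.hasCompactSupport.fderiv (𝕜 := ℝ)).comp_left
    (g := fun L : Vec N →L[ℝ] Vec N => ∑ i, (L (EuclideanSpace.single i 1)) i) (by simp)

theorem isClosed_setOf_TV_le (c : ℝ) (hc : 0 ≤ c) :
    IsClosed {g : L2 Ω | TV Ω g ≤ ENNReal.ofReal c} := by
  have hL : ∀ φ : 𝓓^{1}(Ω, Vec N), MemLp (divergence φ) 2 (leb Ω) := fun φ =>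
    (continuous_divergence φ).memLp_of_hasCompactSupport (hasCompactSupport_divergence φ)
  have e : ∀ (φ : 𝓓^{1}(Ω, Vec N)) (g : L2 Ω),
      ∫ x, g x * divergence φ x ∂leb Ω = inner ℝ g ((hL φ).toLp _) := by
    intro φ g
    rw [L2.inner_def]
    refine integral_congr_ae ((hL φ).coeFn_toLp.mono fun x hx => ?_)
    simp [hx, mul_comm]
  have : {g : L2 Ω | TV Ω g ≤ ENNReal.ofReal c} =
      ⋂ (φ : 𝓓^{1}(Ω, Vec N)) (_ : ∀ x, ‖φ x‖ ≤ 1),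
        {g : L2 Ω | inner ℝ g ((hL φ).toLp _) ≤ c} := by
    ext g
    simp only [Set.mem_ofPred_eq, Set.mem_iInter]
    refine ⟨fun h φ hφ => ?_, fun h => TV_le_of_forall fun φ hφ => ?_⟩
    · rw [← e]; exact integral_mul_divergence_le_of_TV_le hc h φ hφ
    · rw [e]; exact h φ hφ
  rw [this]
  exact isClosed_iInter fun φ => isClosed_iInter fun _ =>
    isClosed_le (by fun_prop) continuous_const

/-- Compactness of bounded functions of bounded variation in `L²`, with no regularity of the
boundary. -/
theorem isCompact_boundedVariationBall (hΩ : Bornology.IsBounded (Ω : Set (Vec N))) {M c : ℝ}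
    (hM : 0 ≤ M) (hc : 0 ≤ c) : IsCompact (boundedVariationBall Ω M c) := by
  have := isFiniteMeasure_leb hΩ
  have : Fact ((2 : ℝ≥0∞) ≠ ⊤) := ⟨by simp⟩
  have hclosed : IsClosed (boundedVariationBall Ω M c) :=
    (isClosed_setOf_ae_mem (C := fun _ => {t : ℝ | |t| ≤ M}) fun _ =>
      isClosed_le continuous_abs continuous_const).inter (isClosed_setOf_TV_le c hc)
  refine IsSeqCompact.isCompact fun u hu => ?_
  have hb : ∀ n, ‖u n‖ ≤ (leb Ω).real Set.univ ^ (ENNReal.toReal 2)⁻¹ * M := fun n =>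
    Lp.norm_le_of_ae_bound hM (hu n).1
  obtain ⟨g, φ, hφ, hw⟩ := exists_subseq_tendsto_inner hb
  obtain ⟨l, hl⟩ := cauchySeq_tendsto_of_complete
    (cauchySeq_of_tendsto_inner hΩ hM hc (u := u ∘ φ) (fun n => hu _) hw)
  exact ⟨l, hclosed.mem_of_tendsto hl (Eventually.of_forall fun n => hu _), φ, hφ, hl⟩

/-! ### Matrix functions and compactness of the admissible controls -/

theorem coeFn_transposeL2 (A : L2Mat Ω) : transposeL2 A =ᵐ[leb Ω] fun x => (A x).transpose :=
  (transposeCLM N).coeFn_compLp A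

theorem continuous_transposeL2 : Continuous (transposeL2 (Ω := Ω)) :=
  ((transposeCLM N).compLpL 2 (leb Ω)).continuous

theorem continuous_symPart : Continuous (symPart (Ω := Ω)) :=
  (continuous_id.add continuous_transposeL2).const_smul (1 / 2 : ℝ)

theorem continuous_skewPart : Continuous (skewPart (Ω := Ω)) :=
  (continuous_id.sub continuous_transposeL2).const_smul (1 / 2 : ℝ)

theorem symPart_add_skewPart (A : L2Mat Ω) : symPart A + skewPart A = A := by
  unfold symPart skewPart
  module

theorem isClosed_SymL2 : IsClosed (SymL2 Ω) :=
  isClosed_setOf_ae_mem (C := fun _ => {S : Mat N | S.transpose = S}) fun _ =>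
    isClosed_eq (transposeCLM N).continuous continuous_id

theorem isClosed_SkewL2 : IsClosed (SkewL2 Ω) :=
  isClosed_setOf_ae_mem (C := fun _ => {S : Mat N | S.transpose = -S}) fun _ =>
    isClosed_eq (transposeCLM N).continuous continuous_neg

theorem continuous_matrix_entry (i j : Fin N) : Continuous fun S : Mat N => S i j :=
  continuous_id.matrix_elem i j

theorem isClosed_setOf_prec : IsClosed {p : L2Mat Ω × L2Mat Ω | Prec p.1 p.2} := by
  refine isClosed_setOf_ae_mem_prod
    (C := fun _ => {p : Mat N × Mat N | ∀ i j : Fin N, i < j → |p.1 i j| ≤ |p.2 i j|})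
    fun _ => ?_
  simp only [Set.ofPred_forall]
  exact isClosed_iInter fun i => isClosed_iInter fun j => isClosed_iInter fun _ =>
    isClosed_le ((continuous_matrix_entry i j).comp continuous_fst).abs
      ((continuous_matrix_entry i j).comp continuous_snd).abs

/-- The action of matrices on Euclidean vectors. -/
def mulVecHom (N : ℕ) : Mat N →ₗ[ℝ] Vec N →L[ℝ] Vec N :=
  LinearMap.toContinuousLinearMap.toLinearMap ∘ₗ
    (Matrix.toEuclideanLin (𝕜 := ℝ) (m := Fin N) (n := Fin N)).toLinearMap

theorem mulVecHom_apply (S : Mat N) (v : Vec N) :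
    mulVecHom N S v = Matrix.toEuclideanLin S v := rfl

theorem continuous_mulVecHom : Continuous (mulVecHom N) :=
  (mulVecHom N).continuous_of_finiteDimensional

/-- A constant comparing the operator norm of a matrix with its largest entry. -/
def opConst (N : ℕ) : ℝ := ∑ i : Fin N, ∑ j : Fin N, ‖mulVecHom N (Matrix.single i j 1)‖

theorem opConst_nonneg : 0 ≤ opConst N :=
  Finset.sum_nonneg fun _ _ => Finset.sum_nonneg fun _ _ => norm_nonneg _

theorem norm_mulVecHom_le (S : Mat N) : ‖mulVecHom N S‖ ≤ opConst N * ‖S‖ := by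
  have e : S = ∑ i, ∑ j, S i j • Matrix.single i j (1 : ℝ) := by
    conv_lhs => rw [Matrix.matrix_eq_sum_single S]
    simp
  conv_lhs => rw [e]
  simp only [map_sum, map_smul, opConst, Finset.sum_mul]
  refine (norm_sum_le _ _).trans (Finset.sum_le_sum fun i _ => ?_)
  refine (norm_sum_le _ _).trans (Finset.sum_le_sum fun j _ => ?_)
  rw [norm_smul, mul_comm]
  exact mul_le_mul_of_nonneg_left (Matrix.norm_entry_le_entrywise_sup_norm S) (norm_nonneg _)

theorem inner_toEuclideanLin_single (S : Mat N) (i j : Fin N) :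
    inner ℝ (Matrix.toEuclideanLin S (EuclideanSpace.single i 1)) (EuclideanSpace.single j 1) =
      S j i := by
  simp [Matrix.toLpLin_apply, EuclideanSpace.inner_single_right]

theorem isClosed_elliptic (α β : ℝ) : IsClosed (elliptic Ω α β) := by
  refine isClosed_SymL2.inter (isClosed_setOf_ae_mem (C := fun _ => {S : Mat N | ∀ ξ : Vec N,
    α * ‖ξ‖ ^ 2 ≤ inner ℝ (Matrix.toEuclideanLin S ξ) ξ ∧
      inner ℝ (Matrix.toEuclideanLin S ξ) ξ ≤ β * ‖ξ‖ ^ 2}) fun _ => ?_)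
  simp only [Set.ofPred_forall]
  refine isClosed_iInter fun ξ => ?_
  have h : Continuous fun S : Mat N => inner ℝ (Matrix.toEuclideanLin S ξ) ξ := by
    simp only [← mulVecHom_apply]
    exact (continuous_mulVecHom.clm_apply continuous_const).inner continuous_const
  exact (isClosed_le continuous_const h).inter (isClosed_le h continuous_const)

/-- Polarization: the quadratic form controls every entry of a symmetric matrix. -/
theorem abs_entry_le_of_quadratic {S : Mat N} (hS : S.transpose = S) {β : ℝ} (hβ : 0 ≤ β)
    (h0 : ∀ ξ : Vec N, 0 ≤ inner ℝ (Matrix.toEuclideanLin S ξ) ξ)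
    (h1 : ∀ ξ : Vec N, inner ℝ (Matrix.toEuclideanLin S ξ) ξ ≤ β * ‖ξ‖ ^ 2) (i j : Fin N) :
    |S i j| ≤ β := by
  have hji : S j i = S i j := congrFun (congrFun hS i) j
  let e : Fin N → Vec N := fun k => EuclideanSpace.single k 1
  have he : ∀ k, ‖e k‖ = 1 := fun k => by simp [e]
  have hsq : ∀ ξ : Vec N, ‖ξ‖ ≤ 2 → β * ‖ξ‖ ^ 2 ≤ 4 * β := fun ξ hξ => by
    have : ‖ξ‖ ^ 2 ≤ 2 ^ 2 := by gcongr
    nlinarith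
  have hp := (h1 (e i + e j)).trans (hsq _ ((norm_add_le _ _).trans (by rw [he, he]; norm_num)))
  have hm := (h1 (e i - e j)).trans (hsq _ ((norm_sub_le _ _).trans (by rw [he, he]; norm_num)))
  have hp0 := h0 (e i + e j)
  have hm0 := h0 (e i - e j)
  simp only [map_add, map_sub, inner_add_left, inner_add_right, inner_sub_left, inner_sub_right,
    e, inner_toEuclideanLin_single] at hp hm hp0 hm0
  rw [abs_le]
  constructor <;> linarith

theorem ae_norm_le_of_mem_elliptic {α β : ℝ} (hα : 0 < α) (hαβ : α ≤ β) {S : L2Mat Ω}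
    (hS : S ∈ elliptic Ω α β) : ∀ᵐ x ∂leb Ω, ‖S x‖ ≤ β := by
  filter_upwards [hS.1, hS.2] with x h1 h2
  have hβ := hα.le.trans hαβ
  rw [Matrix.norm_le_iff hβ]
  exact abs_entry_le_of_quadratic h1 hβ (fun ξ => (by positivity : 0 ≤ α * ‖ξ‖ ^ 2).trans (h2 ξ).1)
    fun ξ => (h2 ξ).2

theorem ae_norm_le_of_prec {K B : L2Mat Ω} (hK : K ∈ SkewL2 Ω) (h : Prec K B) {b : ℝ}
    (hB : ∀ᵐ x ∂leb Ω, ‖B x‖ ≤ b) : ∀ᵐ x ∂leb Ω, ‖K x‖ ≤ b := by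
  filter_upwards [hK, h, hB] with x h1 h2 h3
  have hb : 0 ≤ b := (norm_nonneg _).trans h3
  have hlt : ∀ i j, i < j → |K x i j| ≤ b := fun i j hij =>
    (h2 i j hij).trans (((Matrix.norm_le_iff hb).1 h3) i j)
  have hskew : ∀ i j, K x j i = -K x i j := fun i j => congrFun (congrFun h1 i) j
  rw [Matrix.norm_le_iff hb]
  intro i j
  rw [Real.norm_eq_abs]
  rcases lt_trichotomy i j with hij | rfl | hij
  · exact hlt i j hij
  · have : K x i i = 0 := by linarith [hskew i i]
    simpa [this] using hb
  · rw [hskew j i, abs_neg]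
    exact hlt j i hij

/-- The entries of a matrix function. -/
def entryL2 (i j : Fin N) : L2Mat Ω →L[ℝ] L2 Ω :=
  (LinearMap.toContinuousLinearMap (Matrix.entryLinearMap ℝ ℝ i j)).compLpL 2 (leb Ω)

theorem coeFn_entryL2 (i j : Fin N) (A : L2Mat Ω) :
    entryL2 i j A =ᵐ[leb Ω] fun x => A x i j :=
  (LinearMap.toContinuousLinearMap (Matrix.entryLinearMap ℝ ℝ i j)).coeFn_compLp A

/-- The matrix function with prescribed entries. -/
def ofEntriesL2 (g : Fin N → Fin N → L2 Ω) : L2Mat Ω :=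
  ∑ i, ∑ j, (LinearMap.toContinuousLinearMap
    (Matrix.singleLinearMap ℝ i j : ℝ →ₗ[ℝ] Mat N)).compLpL 2 (leb Ω) (g i j)

theorem continuous_ofEntriesL2 : Continuous (ofEntriesL2 (Ω := Ω)) := by
  unfold ofEntriesL2
  fun_prop

theorem coeFn_sum_Lp {X E ι : Type*} [MeasurableSpace X] {μ : Measure X} [NormedAddCommGroup E]
    {p : ℝ≥0∞} (t : Finset ι) (F : ι → Lp E p μ) :
    ⇑(∑ i ∈ t, F i) =ᵐ[μ] fun x => ∑ i ∈ t, F i x := by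
  classical
  induction t using Finset.induction_on with
  | empty => simp only [Finset.sum_empty]; exact Lp.coeFn_zero E p μ
  | insert i t hi ih =>
    simp only [Finset.sum_insert hi]
    filter_upwards [Lp.coeFn_add (F i) (∑ i ∈ t, F i), ih] with x h1 h2
    rw [h1, Pi.add_apply, h2]

theorem ofEntriesL2_entryL2 (A : L2Mat Ω) : ofEntriesL2 (fun i j => entryL2 i j A) = A := by
  have h : ∀ i j : Fin N, ∀ᵐ x ∂leb Ω, (LinearMap.toContinuousLinearMap
      (Matrix.singleLinearMap ℝ i j : ℝ →ₗ[ℝ] Mat N)).compLpL 2 (leb Ω) (entryL2 i j A) x =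
      Matrix.single i j (A x i j) := fun i j => by
    filter_upwards [(LinearMap.toContinuousLinearMap
      (Matrix.singleLinearMap ℝ i j : ℝ →ₗ[ℝ] Mat N)).coeFn_compLpL (entryL2 i j A),
      coeFn_entryL2 i j A] with x h1 h2
    rw [h1, h2]
    rfl
  refine Lp.ext ((coeFn_sum_Lp _ _).trans ?_)
  filter_upwards [ae_all_iff.2 fun i => ae_all_iff.2 (h i), ae_all_iff.2 fun i =>
    coeFn_sum_Lp Finset.univ fun j => (LinearMap.toContinuousLinearMap
      (Matrix.singleLinearMap ℝ i j : ℝ →ₗ[ℝ] Mat N)).compLpL 2 (leb Ω) (entryL2 i j A)]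
    with x h1 h2
  conv_rhs => rw [Matrix.matrix_eq_sum_single (A x)]
  refine Finset.sum_congr rfl fun i _ => (h2 i).trans ?_
  exact Finset.sum_congr rfl fun j _ => h1 i j

theorem isClosed_AdSym {α β c : ℝ} (hc : 0 ≤ c) : IsClosed (AdSym Ω α β c) := by
  refine IsClosed.inter ?_ (isClosed_elliptic α β)
  have : boundedTV Ω c = SymL2 Ω ∩ ⋂ (i : Fin N) (j : Fin N) (_ : i ≤ j),
      entryL2 i j ⁻¹' {g : L2 Ω | TV Ω g ≤ ENNReal.ofReal c} := by
    ext S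
    simp only [boundedTV, Set.mem_inter_iff, Set.mem_iInter, Set.mem_preimage, Set.mem_ofPred_eq,
      TV_congr (coeFn_entryL2 _ _ S)]
  rw [this]
  exact isClosed_SymL2.inter (isClosed_iInter fun i => isClosed_iInter fun j =>
    isClosed_iInter fun _ => (isClosed_setOf_TV_le c hc).preimage (entryL2 i j).continuous)

theorem isCompact_AdSym (hΩ : Bornology.IsBounded (Ω : Set (Vec N))) {α β c : ℝ} (hα : 0 < α)
    (hαβ : α ≤ β) (hc : 0 ≤ c) : IsCompact (AdSym Ω α β c) := by
  have hK : IsCompact (Set.univ.pi fun _ : Fin N => Set.univ.pi fun _ : Fin N =>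
      boundedVariationBall Ω β c) :=
    isCompact_univ_pi fun _ => isCompact_univ_pi fun _ =>
      isCompact_boundedVariationBall hΩ (hα.le.trans hαβ) hc
  refine (hK.image continuous_ofEntriesL2).of_isClosed_subset (isClosed_AdSym hc) fun S hS => ?_
  refine ⟨fun i j => entryL2 i j S, fun i _ j _ => ⟨?_, ?_⟩, ofEntriesL2_entryL2 S⟩
  · filter_upwards [ae_norm_le_of_mem_elliptic hα hαβ hS.2, coeFn_entryL2 i j S] with x h1 h2
    rw [h2]
    exact (Matrix.norm_le_iff (hα.le.trans hαβ)).1 h1 i j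
  · rw [TV_congr (coeFn_entryL2 i j S)]
    rcases le_total i j with hij | hij
    · exact hS.1.2 i j hij
    · have hsym : ∀ᵐ x ∂leb Ω, (S x).transpose = S x := hS.1.1
      rw [TV_congr (g := fun x => S x i j) (g' := fun x => S x j i)
        (hsym.mono fun x hx => congrFun (congrFun hx j) i)]
      exact hS.1.2 j i hij

/-- All admissible controls, for every majorant, lie in one compact set. -/
theorem exists_isCompact_Ad_subset (hΩ : Bornology.IsBounded (Ω : Set (Vec N))) {α β c : ℝ}
    (hα : 0 < α) (hαβ : α ≤ β) (hc : 0 ≤ c) {Q : Set (L2Mat Ω)} (hQ : IsCompact Q) :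
    ∃ 𝒦 : Set (L2Mat Ω), IsCompact 𝒦 ∧ ∀ B, Ad α β c Q B ⊆ 𝒦 :=
  ⟨_, ((isCompact_AdSym hΩ hα hαβ hc).prod hQ).image continuous_add, fun _ A hA =>
    ⟨(symPart A, skewPart A), ⟨hA.1, hA.2.1.2⟩, symPart_add_skewPart A⟩⟩

/-! ### Bilinear forms with matrix coefficients -/

/-- The Cauchy–Schwarz inequality for a pointwise bound. -/
theorem integrable_and_abs_integral_le {X E F : Type*} [MeasurableSpace X] {μ : Measure X}
    [NormedAddCommGroup E] [NormedAddCommGroup F] (a : Lp E 2 μ) (b : Lp F 2 μ) {C : ℝ}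
    (hC : 0 ≤ C) {f : X → ℝ} (hf : AEStronglyMeasurable f μ)
    (h : ∀ᵐ x ∂μ, |f x| ≤ C * (‖a x‖ * ‖b x‖)) :
    Integrable f μ ∧ |∫ x, f x ∂μ| ≤ C * (‖a‖ * ‖b‖) := by
  have ha := (Lp.memLp a).norm
  have hb := (Lp.memLp b).norm
  have hi : Integrable (fun x => C * (‖a x‖ * ‖b x‖)) μ := (ha.integrable_mul hb).const_mul C
  refine ⟨hi.mono' hf h, ?_⟩
  have h1 : ∫ x, ‖a x‖ * ‖b x‖ ∂μ ≤ ‖a‖ * ‖b‖ := by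
    have e : ∫ x, ‖a x‖ * ‖b x‖ ∂μ = inner ℝ (ha.toLp _) (hb.toLp _) := by
      rw [L2.inner_def]
      refine integral_congr_ae ?_
      filter_upwards [ha.coeFn_toLp, hb.coeFn_toLp] with x h1 h2
      simp [h1, h2, mul_comm]
    rw [e]
    refine (real_inner_le_norm _ _).trans (le_of_eq ?_)
    rw [Lp.norm_toLp, Lp.norm_toLp, eLpNorm_norm, eLpNorm_norm, Lp.norm_def, Lp.norm_def]
  calc |∫ x, f x ∂μ| ≤ ∫ x, C * (‖a x‖ * ‖b x‖) ∂μ := by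
        rw [← Real.norm_eq_abs]
        exact norm_integral_le_of_norm_le hi h
    _ ≤ C * (‖a‖ * ‖b‖) := by
        rw [integral_const_mul]
        exact mul_le_mul_of_nonneg_left h1 hC

/-- `∫_Ω (v, M u) dx`. -/
def trilinear (M : L2Mat Ω) (u : L2Vec Ω) (v : Vec N → Vec N) : ℝ :=
  ∫ x, inner ℝ (v x) (mulVecHom N (M x) (u x)) ∂leb Ω

theorem form_eq_trilinear (M : L2Mat Ω) (y : H10 Ω) (v : Vec N → Vec N) :
    form M y v = trilinear M y.grad v := rfl

theorem aestronglyMeasurable_trilinear (M : L2Mat Ω) (u : L2Vec Ω) {v : Vec N → Vec N}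
    (hv : AEStronglyMeasurable v (leb Ω)) :
    AEStronglyMeasurable (fun x => inner ℝ (v x) (mulVecHom N (M x) (u x))) (leb Ω) := by
  refine hv.inner ?_
  have h : Continuous fun p : (Vec N →L[ℝ] Vec N) × Vec N => p.1 p.2 := by fun_prop
  exact h.comp_aestronglyMeasurable
    ((continuous_mulVecHom.comp_aestronglyMeasurable (Lp.aestronglyMeasurable M)).prodMk
      (Lp.aestronglyMeasurable u))

theorem abs_inner_mulVecHom_le (v : Vec N) (S : Mat N) (u : Vec N) :
    |inner ℝ v (mulVecHom N S u)| ≤ ‖v‖ * (opConst N * ‖S‖ * ‖u‖) :=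
  (abs_real_inner_le_norm _ _).trans
    (mul_le_mul_of_nonneg_left (((mulVecHom N S).le_opNorm u).trans
      (mul_le_mul_of_nonneg_right (norm_mulVecHom_le S) (norm_nonneg _))) (norm_nonneg _))

theorem trilinear_bound_of_matrix {M : L2Mat Ω} {b : ℝ} (hb : 0 ≤ b)
    (hM : ∀ᵐ x ∂leb Ω, ‖M x‖ ≤ b) (u v : L2Vec Ω) :
    Integrable (fun x => inner ℝ (v x) (mulVecHom N (M x) (u x))) (leb Ω) ∧
      |trilinear M u v| ≤ opConst N * b * (‖u‖ * ‖v‖) := by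
  refine integrable_and_abs_integral_le u v (mul_nonneg opConst_nonneg hb)
    (aestronglyMeasurable_trilinear M u (Lp.aestronglyMeasurable v)) ?_
  filter_upwards [hM] with x hx
  calc _ ≤ _ := abs_inner_mulVecHom_le _ _ _
    _ ≤ ‖v x‖ * (opConst N * b * ‖u x‖) := by
        have := opConst_nonneg (N := N)
        gcongr
    _ = _ := by ring

theorem trilinear_bound_of_field {v : Vec N → Vec N} (hvm : AEStronglyMeasurable v (leb Ω)) {b : ℝ}
    (hb : 0 ≤ b) (hv : ∀ x, ‖v x‖ ≤ b) (M : L2Mat Ω) (u : L2Vec Ω) :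
    Integrable (fun x => inner ℝ (v x) (mulVecHom N (M x) (u x))) (leb Ω) ∧
      |trilinear M u v| ≤ opConst N * b * (‖M‖ * ‖u‖) := by
  refine integrable_and_abs_integral_le M u (mul_nonneg opConst_nonneg hb)
    (aestronglyMeasurable_trilinear M u hvm) (ae_of_all _ fun x => ?_)
  calc _ ≤ _ := abs_inner_mulVecHom_le _ _ _
    _ ≤ b * (opConst N * ‖M x‖ * ‖u x‖) := by
        have := opConst_nonneg (N := N)
        gcongr
        exact hv x
    _ = _ := by ring

theorem trilinear_congr (M : L2Mat Ω) (u : L2Vec Ω) {v v' : Vec N → Vec N}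
    (h : v =ᵐ[leb Ω] v') : trilinear M u v = trilinear M u v' :=
  integral_congr_ae (h.mono fun x hx => by simp only [hx])

/-- For an essentially bounded matrix function, `(u, v) ↦ ∫_Ω (v, M u) dx` is a bounded bilinear
form on `L²(Ω; ℝᴺ)`. -/
def boundedForm (M : L2Mat Ω) {b : ℝ} (hb : 0 ≤ b) (hM : ∀ᵐ x ∂leb Ω, ‖M x‖ ≤ b) :
    L2Vec Ω →L[ℝ] L2Vec Ω →L[ℝ] ℝ :=
  LinearMap.mkContinuous₂
    (LinearMap.mk₂ ℝ (fun u v : L2Vec Ω => trilinear M u v)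
      (fun u u' v => by
        unfold trilinear
        rw [← integral_add (trilinear_bound_of_matrix hb hM u v).1
          (trilinear_bound_of_matrix hb hM u' v).1]
        refine integral_congr_ae ((Lp.coeFn_add u u').mono fun x hx => ?_)
        simp only [hx, Pi.add_apply, map_add, inner_add_right])
      (fun r u v => by
        unfold trilinear
        rw [smul_eq_mul, ← integral_const_mul]
        refine integral_congr_ae ((Lp.coeFn_smul r u).mono fun x hx => ?_)
        simp only [hx, Pi.smul_apply, map_smul, inner_smul_right])
      (fun u v v' => by
        unfold trilinear
        rw [← integral_add (trilinear_bound_of_matrix hb hM u v).1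
          (trilinear_bound_of_matrix hb hM u v').1]
        refine integral_congr_ae ((Lp.coeFn_add v v').mono fun x hx => ?_)
        simp only [hx, Pi.add_apply, inner_add_left])
      (fun r u v => by
        unfold trilinear
        rw [smul_eq_mul, ← integral_const_mul]
        refine integral_congr_ae ((Lp.coeFn_smul r v).mono fun x hx => ?_)
        simp only [hx, Pi.smul_apply, real_inner_smul_left]))
    (opConst N * b) fun u v => by
      rw [mul_assoc]
      exact (trilinear_bound_of_matrix hb hM u v).2

theorem boundedForm_apply (M : L2Mat Ω) {b : ℝ} (hb : 0 ≤ b) (hM : ∀ᵐ x ∂leb Ω, ‖M x‖ ≤ b)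
    (u v : L2Vec Ω) : boundedForm M hb hM u v = trilinear M u v := rfl

/-- For a bounded vector field `v`, `(M, u) ↦ ∫_Ω (v, M u) dx` is a bounded bilinear form on
`L²(Ω; 𝕄ᴺ) × L²(Ω; ℝᴺ)`. -/
def fieldForm (v : Vec N → Vec N) (hvm : AEStronglyMeasurable v (leb Ω)) {b : ℝ} (hb : 0 ≤ b)
    (hv : ∀ x, ‖v x‖ ≤ b) : L2Mat Ω →L[ℝ] L2Vec Ω →L[ℝ] ℝ :=
  LinearMap.mkContinuous₂
    (LinearMap.mk₂ ℝ (fun (M : L2Mat Ω) (u : L2Vec Ω) => trilinear M u v)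
      (fun M M' u => by
        unfold trilinear
        rw [← integral_add (trilinear_bound_of_field hvm hb hv M u).1
          (trilinear_bound_of_field hvm hb hv M' u).1]
        refine integral_congr_ae ((Lp.coeFn_add M M').mono fun x hx => ?_)
        simp only [hx, Pi.add_apply, map_add, _root_.add_apply, inner_add_right])
      (fun r M u => by
        unfold trilinear
        rw [smul_eq_mul, ← integral_const_mul]
        refine integral_congr_ae ((Lp.coeFn_smul r M).mono fun x hx => ?_)
        simp only [hx, Pi.smul_apply, map_smul, _root_.smul_apply, inner_smul_right])
      (fun M u u' => by
        unfold trilinear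
        rw [← integral_add (trilinear_bound_of_field hvm hb hv M u).1
          (trilinear_bound_of_field hvm hb hv M u').1]
        refine integral_congr_ae ((Lp.coeFn_add u u').mono fun x hx => ?_)
        simp only [hx, Pi.add_apply, map_add, inner_add_right])
      (fun r M u => by
        unfold trilinear
        rw [smul_eq_mul, ← integral_const_mul]
        refine integral_congr_ae ((Lp.coeFn_smul r u).mono fun x hx => ?_)
        simp only [hx, Pi.smul_apply, map_smul, inner_smul_right]))
    (opConst N * b) fun M u => by
      rw [mul_assoc]
      exact (trilinear_bound_of_field hvm hb hv M u).2

/-- The gradient as a bounded operator on `H¹₀(Ω)`. -/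
def gradCLM (Ω : Opens (Vec N)) : H10 Ω →L[ℝ] L2Vec Ω :=
  (WithLp.sndL 2 ℝ (L2 Ω) (L2Vec Ω)).comp (Submodule.subtypeL _)

/-- The embedding of `H¹₀(Ω)` into `L²(Ω)`. -/
def toL2CLM (Ω : Opens (Vec N)) : H10 Ω →L[ℝ] L2 Ω :=
  (WithLp.fstL 2 ℝ (L2 Ω) (L2Vec Ω)).comp (Submodule.subtypeL _)

theorem norm_sq_eq_H10 (y : H10 Ω) : ‖y‖ ^ 2 = ‖y.toL2‖ ^ 2 + ‖y.grad‖ ^ 2 :=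
  WithLp.prod_norm_sq_eq_of_L2 (y : WithLp 2 (L2 Ω × L2Vec Ω))

theorem coeFn_grad_testH10 (φ : 𝓓(Ω, ℝ)) :
    (testH10 φ).grad =ᵐ[leb Ω] ∇ (φ : Vec N → ℝ) :=
  (memLp_gradient_test φ).coeFn_toLp

theorem form_test (M : L2Mat Ω) (y : H10 Ω) (φ : 𝓓(Ω, ℝ)) :
    form M y (∇ φ) = trilinear M y.grad (testH10 φ).grad :=
  trilinear_congr M y.grad (coeFn_grad_testH10 φ).symm

theorem denseRange_testH10 : DenseRange (testH10 (Ω := Ω)) := by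
  rw [DenseRange, Subtype.dense_iff]
  intro y hy
  rw [← Set.range_comp]
  exact hy

theorem norm_grad_testH10_sq (φ : 𝓓(Ω, ℝ)) :
    ‖(testH10 φ).grad‖ ^ 2 = ∫ x, ‖∇ (φ : Vec N → ℝ) x‖ ^ 2 ∂leb Ω := by
  rw [← real_inner_self_eq_norm_sq, L2.inner_def]
  exact integral_congr_ae ((coeFn_grad_testH10 φ).mono fun x hx => by
    simp only [hx, real_inner_self_eq_norm_sq])

/-! ### The Poincaré inequality and weak compactness -/

theorem coeFn_toL2_testH10 (φ : 𝓓(Ω, ℝ)) : (testH10 φ).toL2 =ᵐ[leb Ω] φ :=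
  (memLp_test φ).coeFn_toLp

theorem inner_gradient_test (φ : 𝓓(Ω, ℝ)) (x v : Vec N) :
    inner ℝ (∇ (φ : Vec N → ℝ) x) v = fderiv ℝ φ x v := by
  simp [gradient]

/-- Integration by parts against the coordinate `x i`, whose derivative in direction `i` is `1`. -/
theorem integral_sq_test (φ : 𝓓(Ω, ℝ)) (i : Fin N) :
    ∫ x, φ x ^ 2 ∂leb Ω =
      -∫ x, x i * (2 * φ x * fderiv ℝ φ x (EuclideanSpace.single i 1)) ∂leb Ω := by
  set e : Vec N := EuclideanSpace.single i 1
  have hzero : ∀ x, x ∉ (Ω : Set (Vec N)) → φ x = 0 := fun x hx =>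
    image_eq_zero_of_notMem_tsupport fun h => hx (φ.tsupport_subset h)
  have hd : Differentiable ℝ φ := φ.contDiff.differentiable (by simp)
  have hfd : Continuous fun x => fderiv ℝ φ x e :=
    (φ.contDiff.continuous_fderiv (by simp)).clm_apply continuous_const
  have hsq : ∀ x, fderiv ℝ (fun y => φ y * φ y) x e = 2 * φ x * fderiv ℝ φ x e := fun x => by
    rw [fderiv_fun_mul (hd x) (hd x)]
    simp only [_root_.add_apply, _root_.smul_apply, smul_eq_mul]
    ring
  have hp : ∀ x, fderiv ℝ (fun y : Vec N => y i) x e = 1 := fun x => by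
    have : (fun y : Vec N => y i) = EuclideanSpace.proj (𝕜 := ℝ) i := rfl
    rw [this, ContinuousLinearMap.fderiv]
    simp [e]
  have hφc : Continuous φ := φ.continuous
  have hxi : Continuous fun x : Vec N => x i := by fun_prop
  have hcs : HasCompactSupport φ := φ.hasCompactSupport
  have hcs2 : HasCompactSupport fun x => φ x * φ x := hcs.mul_left
  have key := integral_mul_fderiv_eq_neg_fderiv_mul_of_integrable (μ := (volume : Measure (Vec N)))
    (f := fun x : Vec N => x i) (g := fun x => φ x * φ x) (v := e) ?_ ?_ ?_
    (fun x _ => (EuclideanSpace.proj (𝕜 := ℝ) i).differentiableAt) (fun x _ => (hd x).mul (hd x))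
  · simp only [hsq, hp, one_mul] at key
    rw [setIntegral_eq_integral_of_forall_compl_eq_zero fun x hx => by simp [hzero x hx],
      setIntegral_eq_integral_of_forall_compl_eq_zero fun x hx => by simp [hzero x hx], key,
      neg_neg]
    simp only [sq]
  · simp only [hp, one_mul]
    exact (hφc.mul hφc).integrable_of_hasCompactSupport hcs2
  · simp only [hsq]
    exact Continuous.integrable_of_hasCompactSupport (by fun_prop)
      ((hcs.mul_left (f := fun _ => (2 : ℝ))).mul_right.mul_left)
  · exact Continuous.integrable_of_hasCompactSupport (by fun_prop) hcs2.mul_left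

/-- The Poincaré–Friedrichs inequality on a bounded open set. -/
theorem exists_poincare (hN : 0 < N) (hΩ : Bornology.IsBounded (Ω : Set (Vec N))) :
    ∃ C : ℝ, 0 ≤ C ∧ ∀ y : H10 Ω, ‖y.toL2‖ ≤ C * ‖y.grad‖ := by
  obtain ⟨R, hR⟩ := hΩ.exists_norm_le
  have hR' : ∀ x ∈ (Ω : Set (Vec N)), ‖x‖ ≤ |R| := fun x hx => (hR x hx).trans (le_abs_self R)
  refine ⟨2 * |R|, by positivity, fun y => ?_⟩
  have hclosed : IsClosed {y : H10 Ω | ‖y.toL2‖ ≤ 2 * |R| * ‖y.grad‖} :=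
    isClosed_le (toL2CLM Ω).continuous.norm (continuous_const.mul (gradCLM Ω).continuous.norm)
  refine denseRange_testH10.induction_on (p := fun y => ‖y.toL2‖ ≤ 2 * |R| * ‖y.grad‖) y hclosed
    fun φ => ?_
  have hae : ∀ᵐ x ∂leb Ω, x ∈ (Ω : Set (Vec N)) := ae_restrict_mem Ω.isOpen.measurableSet
  let i : Fin N := ⟨0, hN⟩
  have hsq : ‖(testH10 φ).toL2‖ ^ 2 = ∫ x, φ x ^ 2 ∂leb Ω := by
    rw [← real_inner_self_eq_norm_sq, L2.inner_def]
    exact integral_congr_ae ((coeFn_toL2_testH10 φ).mono fun x hx => by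
      simp [hx, sq])
  have hb := (integrable_and_abs_integral_le (testH10 φ).toL2 (testH10 φ).grad
    (C := 2 * |R|) (by positivity) (f := fun x => x i * (2 * φ x * fderiv ℝ φ x
      (EuclideanSpace.single i 1))) ?_ ?_).2
  · have h2 : ‖(testH10 φ).toL2‖ ^ 2 ≤
        2 * |R| * (‖(testH10 φ).toL2‖ * ‖(testH10 φ).grad‖) := by
      rw [hsq, integral_sq_test φ i]
      exact (neg_le_abs _).trans hb
    rcases (norm_nonneg (testH10 φ).toL2).eq_or_lt with h0 | h0
    · rw [← h0]; positivity
    · exact le_of_mul_le_mul_left (by linarith [h2]) h0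
  · have hfd : Continuous fun x => fderiv ℝ φ x (EuclideanSpace.single i 1) :=
      (φ.contDiff.continuous_fderiv (by simp)).clm_apply continuous_const
    have hφc : Continuous φ := φ.continuous
    exact Continuous.aestronglyMeasurable (by fun_prop)
  · filter_upwards [hae, coeFn_toL2_testH10 φ, coeFn_grad_testH10 φ] with x hx h1 h2
    rw [h1, h2, abs_mul, abs_mul, abs_mul, abs_two, ← Real.norm_eq_abs (φ x)]
    have h3 : |x i| ≤ |R| := (PiLp.norm_apply_le x i).trans (hR' x hx)
    have h4 : |fderiv ℝ φ x (EuclideanSpace.single i 1)| ≤ ‖∇ (φ : Vec N → ℝ) x‖ := by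
      rw [← inner_gradient_test]
      refine (abs_real_inner_le_norm _ _).trans (le_of_eq ?_)
      simp
    calc |x i| * (2 * ‖φ x‖ * |fderiv ℝ φ x (EuclideanSpace.single i 1)|)
        ≤ |R| * (2 * ‖φ x‖ * ‖∇ (φ : Vec N → ℝ) x‖) := by gcongr
      _ = 2 * |R| * (‖φ x‖ * ‖∇ (φ : Vec N → ℝ) x‖) := by ring

/-- On a bounded open set the gradient controls the `H¹₀` norm. -/
theorem exists_norm_le_grad (hN : 0 < N) (hΩ : Bornology.IsBounded (Ω : Set (Vec N))) :
    ∃ C : ℝ, 0 < C ∧ ∀ y : H10 Ω, ‖y‖ ≤ C * ‖y.grad‖ := by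
  obtain ⟨C, hC, h⟩ := exists_poincare hN hΩ
  refine ⟨C + 1, by positivity, fun y => ?_⟩
  refine abs_le_of_sq_le_sq' ?_ (by positivity) |>.2
  rw [norm_sq_eq_H10]
  have := h y
  have h2 : ‖y.toL2‖ ^ 2 ≤ (C * ‖y.grad‖) ^ 2 := by gcongr
  nlinarith [sq_nonneg ‖y.grad‖, mul_nonneg hC (sq_nonneg ‖y.grad‖)]

/-- Weak compactness of balls in a Hilbert space. -/
theorem isCompact_image_toWeakSpace_closedBall {H : Type*} [NormedAddCommGroup H]
    [InnerProductSpace ℝ H] [CompleteSpace H] (R : ℝ) :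
    IsCompact (toWeakSpace ℝ H '' Metric.closedBall 0 R) := by
  -- The Riesz map carries the weak-* compact ball of the dual onto the ball.
  let T : WeakDual ℝ H → WeakSpace ℝ H := fun F =>
    toWeakSpace ℝ H ((InnerProductSpace.toDual ℝ H).symm (WeakDual.toStrongDual F))
  have hT : Continuous T := by
    refine WeakBilin.continuous_of_continuous_eval _ fun ℓ => ?_
    have : (fun F => (topDualPairing ℝ H).flip (T F) ℓ) =
        fun F : WeakDual ℝ H => F ((InnerProductSpace.toDual ℝ H).symm ℓ) := by
      funext F
      change ℓ ((InnerProductSpace.toDual ℝ H).symm (WeakDual.toStrongDual F)) = _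
      rw [← InnerProductSpace.toDual_symm_apply (y := ℓ), real_inner_comm,
        InnerProductSpace.toDual_symm_apply]
      rfl
    rw [this]
    exact WeakDual.eval_continuous _
  convert (WeakDual.isCompact_closedBall (𝕜 := ℝ) (E := H) 0 R).image hT using 1
  ext w
  constructor
  · rintro ⟨y, hy, rfl⟩
    refine ⟨StrongDual.toWeakDual (InnerProductSpace.toDual ℝ H y), ?_, ?_⟩
    · simpa [StrongDual.toStrongDual_toWeakDual] using hy
    · simp [T, StrongDual.toStrongDual_toWeakDual]
  · rintro ⟨F, hF, rfl⟩
    exact ⟨_, by simpa using hF, rfl⟩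

/-- A bounded bilinear map is continuous for strong convergence in the first and bounded weak
convergence in the second argument. -/
theorem tendsto_bilin_of_weak {ι E F : Type*} [NormedAddCommGroup E] [NormedSpace ℝ E]
    [NormedAddCommGroup F] [NormedSpace ℝ F] (B : E →L[ℝ] F →L[ℝ] ℝ) {l : Filter ι} {A : ι → E}
    {a : E} (hA : Tendsto A l (𝓝 a)) {u : ι → F} {v : F} {R : ℝ} (hR : ∀ᶠ n in l, ‖u n‖ ≤ R)
    (hu : ∀ ℓ : StrongDual ℝ F, Tendsto (fun n => ℓ (u n)) l (𝓝 (ℓ v))) :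
    Tendsto (fun n => B (A n) (u n)) l (𝓝 (B a v)) := by
  -- Strong convergence of `A n` handles the difference, uniformly on bounded sets.
  have h1 : Tendsto (fun n => B (A n - a) (u n)) l (𝓝 0) := by
    have h2 : Tendsto (fun n => ‖B‖ * ‖A n - a‖ * |R|) l (𝓝 0) := by
      have := (((hA.sub_const a).norm).const_mul ‖B‖).mul_const |R|
      simpa using this
    refine squeeze_zero_norm' (hR.mono fun n hn => ?_) h2
    refine (B.le_opNorm₂ _ _).trans ?_
    exact mul_le_mul_of_nonneg_left (hn.trans (le_abs_self R)) (by positivity)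
  have := h1.add (hu (B a))
  simpa using this

/-! ### Weak solutions, a priori bounds and the extended skew form -/

theorem le_trilinear_self {α β : ℝ} (hα : 0 < α) (hαβ : α ≤ β) {S : L2Mat Ω}
    (hS : S ∈ elliptic Ω α β) (u : L2Vec Ω) : α * ‖u‖ ^ 2 ≤ trilinear S u u := by
  have hu : Integrable (fun x => ‖u x‖ ^ 2) (leb Ω) :=
    (memLp_two_iff_integrable_sq_norm (Lp.aestronglyMeasurable u)).1 (Lp.memLp u)
  have e : ‖u‖ ^ 2 = ∫ x, ‖u x‖ ^ 2 ∂leb Ω := by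
    rw [← real_inner_self_eq_norm_sq, L2.inner_def]
    simp only [real_inner_self_eq_norm_sq]
  rw [e, ← integral_const_mul]
  refine integral_mono_ae (hu.const_mul α) (trilinear_bound_of_matrix (hα.le.trans hαβ)
    (ae_norm_le_of_mem_elliptic hα hαβ hS) u u).1 (hS.2.mono fun x hx => ?_)
  simp only
  rw [real_inner_comm]
  exact (hx (u x)).1

theorem inner_toEuclideanLin_eq (S : Mat N) (v w : Vec N) :
    inner ℝ v (Matrix.toEuclideanLin S w) =
      inner ℝ w (Matrix.toEuclideanLin S.transpose v) := by
  rw [← Matrix.conjTranspose_eq_transpose_of_trivial,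
    Matrix.toEuclideanLin_conjTranspose_eq_adjoint, LinearMap.adjoint_inner_right, real_inner_comm]

theorem trilinear_self_eq_zero {K : L2Mat Ω} (hK : K ∈ SkewL2 Ω) (u : L2Vec Ω) :
    trilinear K u u = 0 := by
  refine integral_eq_zero_of_ae ?_
  have hK' : ∀ᵐ x ∂leb Ω, (K x).transpose = -(K x) := hK
  filter_upwards [hK'] with x hx
  have := inner_toEuclideanLin_eq (K x) (u x) (u x)
  rw [hx, map_neg, LinearMap.neg_apply, inner_neg_right] at this
  rw [mulVecHom_apply, Pi.zero_apply]
  linarith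

theorem trilinear_comm {S : L2Mat Ω} (hS : S ∈ SymL2 Ω) (u v : L2Vec Ω) :
    trilinear S u v = trilinear S v u := by
  have hS' : ∀ᵐ x ∂leb Ω, (S x).transpose = S x := hS
  refine integral_congr_ae (hS'.mono fun x hx => ?_)
  have := inner_toEuclideanLin_eq (S x) (v x) (u x)
  rw [hx] at this
  exact this

/-- An elliptic symmetric part and an essentially bounded skew part: the controls for which the
Lax–Milgram theorem applies. -/
structure BoundedControl (α β b : ℝ) (A : L2Mat Ω) : Prop where
  sym : symPart A ∈ elliptic Ω α β
  skew : skewPart A ∈ SkewL2 Ω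
  bdd : ∀ᵐ x ∂leb Ω, ‖skewPart A x‖ ≤ b

section Bounded

variable {α β b : ℝ} {A : L2Mat Ω}

/-- The bilinear form `(y, v) ↦ ∫_Ω (∇v, A ∇y) dx` on `H¹₀(Ω)` for an essentially bounded `A`. -/
def controlForm (hα : 0 < α) (hαβ : α ≤ β) (hb : 0 ≤ b) (hA : BoundedControl α β b A) :
    H10 Ω →L[ℝ] H10 Ω →L[ℝ] ℝ :=
  (boundedForm (symPart A) (hα.le.trans hαβ) (ae_norm_le_of_mem_elliptic hα hαβ hA.sym) +
    boundedForm (skewPart A) hb hA.bdd).bilinearComp (gradCLM Ω) (gradCLM Ω)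

theorem controlForm_apply (hα : 0 < α) (hαβ : α ≤ β) (hb : 0 ≤ b) (hA : BoundedControl α β b A)
    (y v : H10 Ω) : controlForm hα hαβ hb hA y v =
      trilinear (symPart A) y.grad v.grad + trilinear (skewPart A) y.grad v.grad := rfl

theorem isWeakSolution_iff (hα : 0 < α) (hαβ : α ≤ β) (hb : 0 ≤ b) (hA : BoundedControl α β b A)
    (f : StrongDual ℝ (H10 Ω)) (y : H10 Ω) :
    IsWeakSolution f A y ↔ ∀ v, controlForm hα hαβ hb hA y v = f v := by
  simp only [IsWeakSolution, form_test]
  refine ⟨fun h => ?_, fun h φ =>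
    (controlForm_apply hα hαβ hb hA y _).symm.trans (h (testH10 φ))⟩
  -- Both sides are continuous in `v`, and test functions are dense.
  have h' : ⇑(controlForm hα hαβ hb hA y) ∘ testH10 = f ∘ testH10 :=
    funext fun φ => (controlForm_apply hα hαβ hb hA y _).trans (h φ)
  exact congrFun (denseRange_testH10.equalizer (controlForm hα hαβ hb hA y).continuous f.continuous
    h')

/-- The skew part of a bounded control does not contribute to the energy of its state. -/
theorem energy_identity (hα : 0 < α) (hαβ : α ≤ β) (hb : 0 ≤ b) (hA : BoundedControl α β b A)
    {f : StrongDual ℝ (H10 Ω)} {y : H10 Ω} (hy : IsWeakSolution f A y) :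
    form (symPart A) y y.grad = f y := by
  have := (isWeakSolution_iff hα hαβ hb hA f y).1 hy y
  rw [controlForm_apply, trilinear_self_eq_zero hA.skew, add_zero] at this
  exact this

theorem existsUnique_isWeakSolution (hN : 0 < N) (hΩ : Bornology.IsBounded (Ω : Set (Vec N)))
    (hα : 0 < α) (hαβ : α ≤ β) (hb : 0 ≤ b) (hA : BoundedControl α β b A)
    (f : StrongDual ℝ (H10 Ω)) : ∃! y : H10 Ω, IsWeakSolution f A y := by
  obtain ⟨C, hC, hP⟩ := exists_norm_le_grad hN hΩ
  have hco : IsCoercive (controlForm hα hαβ hb hA) := by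
    refine ⟨α / C ^ 2, by positivity, fun y => ?_⟩
    rw [controlForm_apply, trilinear_self_eq_zero hA.skew, add_zero]
    refine le_trans ?_ (le_trilinear_self hα hαβ hA.sym y.grad)
    have h1 : ‖y‖ ^ 2 ≤ (C * ‖y.grad‖) ^ 2 := by
      have := hP y
      gcongr
    calc α / C ^ 2 * ‖y‖ * ‖y‖ = α / C ^ 2 * ‖y‖ ^ 2 := by ring
      _ ≤ α / C ^ 2 * (C * ‖y.grad‖) ^ 2 := by gcongr
      _ = α * ‖y.grad‖ ^ 2 := by field_simp
  let L := hco.continuousLinearEquivOfBilin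
  let F := (InnerProductSpace.toDual ℝ (H10 Ω)).symm f
  have hiff : ∀ y, IsWeakSolution f A y ↔ L y = F := by
    intro y
    rw [isWeakSolution_iff hα hαβ hb hA]
    constructor
    · intro h
      refine ext_inner_right ℝ fun v => ?_
      rw [hco.continuousLinearEquivOfBilin_apply, InnerProductSpace.toDual_symm_apply, h v]
    · intro h v
      rw [← hco.continuousLinearEquivOfBilin_apply y v]
      change inner ℝ (L y) v = _
      rw [h, InnerProductSpace.toDual_symm_apply]
  refine ⟨L.symm F, (hiff _).2 (L.apply_symm_apply F), fun y hy => ?_⟩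
  exact (L.eq_symm_apply).2 ((hiff y).1 hy)

end Bounded

/-- The a priori bound for weak solutions does not depend on the size of the skew part. -/
theorem exists_norm_le_of_isWeakSolution (hN : 0 < N) (hΩ : Bornology.IsBounded (Ω : Set (Vec N)))
    {α β : ℝ} (hα : 0 < α) (hαβ : α ≤ β) (f : StrongDual ℝ (H10 Ω)) :
    ∃ R : ℝ, ∀ (b : ℝ) (A : L2Mat Ω) (y : H10 Ω), 0 ≤ b → BoundedControl α β b A →
      IsWeakSolution f A y → ‖y‖ ≤ R := by
  obtain ⟨C, hC, hP⟩ := exists_norm_le_grad hN hΩ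
  refine ⟨C * (C * ‖f‖ / α), fun b A y hb hA hy => (hP y).trans ?_⟩
  gcongr
  have h1 : α * ‖y.grad‖ ^ 2 ≤ ‖f‖ * (C * ‖y.grad‖) :=
    calc α * ‖y.grad‖ ^ 2 ≤ f y :=
          (le_trilinear_self hα hαβ hA.sym _).trans_eq (energy_identity hα hαβ hb hA hy)
      _ ≤ ‖f‖ * ‖y‖ := (le_abs_self _).trans (f.le_opNorm y)
      _ ≤ ‖f‖ * (C * ‖y.grad‖) := by
          gcongr
          exact hP y
  rw [le_div_iff₀ hα]
  rcases (norm_nonneg y.grad).eq_or_lt with h0 | h0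
  · rw [← h0, zero_mul]
    positivity
  · exact le_of_mul_le_mul_left (by linarith) h0

theorem tendsto_dual_of_tendsto_toWeakSpace {ι H : Type*} [NormedAddCommGroup H]
    [NormedSpace ℝ H] {l : Filter ι} {u : ι → H} {v : H}
    (h : Tendsto (fun n => toWeakSpace ℝ H (u n)) l (𝓝 (toWeakSpace ℝ H v)))
    (ℓ : StrongDual ℝ H) : Tendsto (fun n => ℓ (u n)) l (𝓝 (ℓ v)) :=
  ((WeakBilin.eval_continuous (topDualPairing ℝ H).flip ℓ).tendsto _).comp h

/-- Against a fixed test function the form is jointly continuous for strong convergence of the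
matrices, which may be unbounded, and bounded weak convergence of the states. -/
theorem tendsto_form_test {ι : Type*} {l : Filter ι} {M : ι → L2Mat Ω} {M₀ : L2Mat Ω}
    (hM : Tendsto M l (𝓝 M₀)) {y : ι → H10 Ω} {y₀ : H10 Ω} {R : ℝ} (hR : ∀ n, ‖y n‖ ≤ R)
    (hy : Tendsto (fun n => toWeakSpace ℝ (H10 Ω) (y n)) l (𝓝 (toWeakSpace ℝ (H10 Ω) y₀)))
    (φ : 𝓓(Ω, ℝ)) :
    Tendsto (fun n => form (M n) (y n) (∇ φ)) l (𝓝 (form M₀ y₀ (∇ φ))) := by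
  obtain ⟨b, hb⟩ := (continuous_gradient_test φ).bounded_above_of_compact_support
    (hasCompactSupport_gradient_test φ)
  have hb0 : 0 ≤ b := (norm_nonneg _).trans (hb 0)
  exact tendsto_bilin_of_weak ((ContinuousLinearMap.flip ((fieldForm (∇ φ)
    (continuous_gradient_test φ).aestronglyMeasurable hb0 hb).flip.comp (gradCLM Ω)))) hM
    (Eventually.of_forall hR) (tendsto_dual_of_tendsto_toWeakSpace hy)

/-- A solution of the integral identity on test functions whose symmetric part is bounded belongs
to `D(A)`, and the identity determines the extended skew form. -/
theorem mem_D_and_bracket_eq (hN : 0 < N) (hΩ : Bornology.IsBounded (Ω : Set (Vec N)))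
    {α β : ℝ} (hα : 0 < α) (hαβ : α ≤ β) {A : L2Mat Ω} (hA : symPart A ∈ elliptic Ω α β)
    {f : StrongDual ℝ (H10 Ω)} {y : H10 Ω} (hy : IsWeakSolution f A y) :
    y ∈ D A ∧ ∀ v, bracket A y v = f v - form (symPart A) y v.grad := by
  have hβ := hα.le.trans hαβ
  have hb := ae_norm_le_of_mem_elliptic hα hαβ hA
  let G : StrongDual ℝ (H10 Ω) := f - (boundedForm (symPart A) hβ hb y.grad).comp (gradCLM Ω)
  have hG : ∀ v, G v = f v - form (symPart A) y v.grad := fun v => rfl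
  have hbr : ∀ φ, bracketTest A y φ = G (testH10 φ) := by
    intro φ
    have := hy φ
    rw [hG, bracketTest, ← this, form_test (symPart A), ← form_eq_trilinear]
    ring
  constructor
  · obtain ⟨C, hC, hP⟩ := exists_norm_le_grad hN hΩ
    refine ⟨‖G‖ * C, fun φ => ?_⟩
    rw [← norm_grad_testH10_sq, Real.sqrt_sq (norm_nonneg _), hbr, mul_assoc]
    exact (G.le_opNorm _).trans (mul_le_mul_of_nonneg_left (hP _) (by positivity))
  · intro v
    have : (comap (testH10 (Ω := Ω)) (𝓝 v)).NeBot :=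
      comap_neBot_iff.2 fun t ht => by
        obtain ⟨_, hx, φ, rfl⟩ := mem_closure_iff_nhds.1 (denseRange_testH10 v) t ht
        exact ⟨φ, hx⟩
    refine Tendsto.limUnder_eq ?_
    rw [← hG, show bracketTest A y = G ∘ testH10 from funext hbr]
    exact (G.continuous.tendsto v).comp tendsto_comap

/-! ### Minimizers and limits of regularized pairs -/

theorem integral_divergence_eq_zero (φ : 𝓓^{1}(Ω, Vec N)) :
    ∫ x, divergence φ x ∂leb Ω = 0 := by
  have hd : Differentiable ℝ φ := φ.contDiff.differentiable (by simp)
  have hzero : ∀ x, x ∉ (Ω : Set (Vec N)) → divergence φ x = 0 := fun x hx => by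
    have : fderiv ℝ φ x = 0 := image_eq_zero_of_notMem_tsupport fun h =>
      hx (φ.tsupport_subset (tsupport_fderiv_subset ℝ h))
    simp [divergence, this]
  rw [setIntegral_eq_integral_of_forall_compl_eq_zero hzero]
  have hfc : Continuous (fderiv ℝ φ) := φ.contDiff.continuous_fderiv (by simp)
  have hcs : HasCompactSupport (fderiv ℝ φ) := φ.hasCompactSupport.fderiv (𝕜 := ℝ)
  have hint : ∀ i : Fin N, Integrable fun x => fderiv ℝ φ x (EuclideanSpace.single i 1) i :=
    fun i => Continuous.integrable_of_hasCompactSupport (by fun_prop)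
      (hcs.comp_left (g := fun L : Vec N →L[ℝ] Vec N => L (EuclideanSpace.single i 1) i)
        (by simp))
  unfold divergence
  rw [integral_finsetSum _ fun i _ => hint i]
  refine Finset.sum_eq_zero fun i _ => ?_
  have he : ∀ x, fderiv ℝ (fun y => φ y i) x (EuclideanSpace.single i 1) =
      fderiv ℝ φ x (EuclideanSpace.single i 1) i := fun x => by
    have := ((EuclideanSpace.proj (𝕜 := ℝ) i).hasFDerivAt.comp x (hd x).hasFDerivAt).fderiv
    change fderiv ℝ (EuclideanSpace.proj (𝕜 := ℝ) i ∘ φ) x _ = _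
    rw [this]
    rfl
  have hφi : Integrable fun x => φ x i :=
    Continuous.integrable_of_hasCompactSupport (by have := φ.continuous; fun_prop)
      (φ.hasCompactSupport.comp_left (g := fun v : Vec N => v i) (by simp))
  have hdi : Differentiable ℝ fun y => φ y i :=
    (EuclideanSpace.proj (𝕜 := ℝ) i).differentiable.comp hd
  have key := integral_mul_fderiv_eq_neg_fderiv_mul_of_integrable
    (μ := (volume : Measure (Vec N))) (f := fun _ : Vec N => (1 : ℝ)) (g := fun x => φ x i)
    (v := EuclideanSpace.single i 1) (by simp) (by simpa [he] using hint i) (by simpa using hφi)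
    (fun x _ => differentiableAt_const _) (fun x _ => hdi x)
  simpa [he] using key

theorem TV_const (k : ℝ) : TV Ω (fun _ => k) = 0 := by
  simp [TV, integral_const_mul, integral_divergence_eq_zero]

/-- The constant control `α I` is admissible for every majorant. -/
theorem Ad_nonempty (hΩ : Bornology.IsBounded (Ω : Set (Vec N))) {α β c : ℝ}
    (hαβ : α ≤ β) {Q : Set (L2Mat Ω)} (hQ0 : (0 : L2Mat Ω) ∈ Q) (B : L2Mat Ω) :
    (Ad α β c Q B).Nonempty := by
  have := isFiniteMeasure_leb hΩ
  have hL : MemLp (fun _ : Vec N => α • (1 : Mat N)) 2 (leb Ω) := memLp_const _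
  let A : L2Mat Ω := hL.toLp _
  have hA : A =ᵐ[leb Ω] fun _ => α • (1 : Mat N) := hL.coeFn_toLp
  have hAs : A ∈ SymL2 Ω := hA.mono fun x hx => by
    rw [hx, Matrix.transpose_smul, Matrix.transpose_one]
  have hT : transposeL2 A = A := by
    refine Lp.ext ?_
    have hAs' : ∀ᵐ x ∂leb Ω, (A x).transpose = A x := hAs
    filter_upwards [coeFn_transposeL2 A, hAs'] with x h1 h2
    rw [h1, h2]
  have hsym : symPart A = A := by
    unfold symPart
    rw [hT]
    module
  have hskew : skewPart A = 0 := by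
    unfold skewPart
    rw [hT, sub_self, smul_zero]
  have h0 : (0 : L2Mat Ω) ∈ SkewL2 Ω := by
    filter_upwards [Lp.coeFn_zero (Mat N) 2 (leb Ω)] with x hx
    rw [hx]
    simp
  refine ⟨A, ?_, ?_⟩
  · rw [hsym]
    refine ⟨⟨hAs, fun i j _ => ?_⟩, hAs, hA.mono fun x hx ξ => ?_⟩
    · rw [TV_congr (g' := fun _ => (α • (1 : Mat N)) i j) (hA.mono fun x hx => by
        simp only [hx]), TV_const]
      exact zero_le
    · have e : inner ℝ (Matrix.toEuclideanLin (A x) ξ) ξ = α * ‖ξ‖ ^ 2 := by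
        rw [hx, map_smul, LinearMap.smul_apply, real_inner_smul_left]
        simp
      rw [e]
      exact ⟨le_rfl, mul_le_mul_of_nonneg_right hαβ (by positivity)⟩
  · rw [hskew]
    refine ⟨⟨h0, hQ0⟩, h0, ?_⟩
    filter_upwards [Lp.coeFn_zero (Mat N) 2 (leb Ω)] with x hx i j _
    rw [hx]
    simp

theorem exists_ae_norm_le_of_memLp_top {B : L2Mat Ω} (hB : MemLp B ⊤ (leb Ω)) :
    ∃ b : ℝ, 0 ≤ b ∧ ∀ᵐ x ∂leb Ω, ‖B x‖ ≤ b := by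
  have hfin : eLpNormEssSup B (leb Ω) ≠ ⊤ := by simpa using hB.2.ne
  refine ⟨(eLpNormEssSup B (leb Ω)).toReal, ENNReal.toReal_nonneg, ?_⟩
  filter_upwards [ae_le_eLpNormEssSup (f := B) (μ := leb Ω)] with x hx
  rw [← toReal_enorm]
  exact ENNReal.toReal_mono hfin hx

theorem boundedControl_of_mem_Ad {α β c b : ℝ} {Q : Set (L2Mat Ω)} {A B : L2Mat Ω}
    (hB : ∀ᵐ x ∂leb Ω, ‖B x‖ ≤ b) (hA : A ∈ Ad α β c Q B) : BoundedControl α β b A :=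
  ⟨hA.1.2, hA.2.1.1, ae_norm_le_of_prec hA.2.1.1 hA.2.2.2 hB⟩

/-- Admissibility passes to strong limits, also when the majorant varies and converges. -/
theorem mem_Ad_of_tendsto {ι : Type*} {l : Filter ι} [l.NeBot] {α β c : ℝ} (hc : 0 ≤ c)
    {Q : Set (L2Mat Ω)} (hQ : IsClosed Q) {A B : ι → L2Mat Ω} {A₀ B₀ : L2Mat Ω}
    (hA : Tendsto A l (𝓝 A₀)) (hB : Tendsto B l (𝓝 B₀)) (h : ∀ n, A n ∈ Ad α β c Q (B n)) :
    A₀ ∈ Ad α β c Q B₀ := by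
  have hsk := (continuous_skewPart.tendsto A₀).comp hA
  have hskew : skewPart A₀ ∈ SkewL2 Ω :=
    isClosed_SkewL2.mem_of_tendsto hsk (Eventually.of_forall fun n => (h n).2.1.1)
  refine ⟨(isClosed_AdSym hc).mem_of_tendsto ((continuous_symPart.tendsto A₀).comp hA)
    (Eventually.of_forall fun n => (h n).1), ⟨hskew, ?_⟩, hskew, ?_⟩
  · exact hQ.mem_of_tendsto hsk (Eventually.of_forall fun n => (h n).2.1.2)
  · exact isClosed_setOf_prec.mem_of_tendsto (hsk.prodMk_nhds hB)
      (Eventually.of_forall fun n => (h n).2.2.2)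

theorem tendsto_toTau_iff {ι : Type*} {l : Filter ι} {p : ι → L2Mat Ω × H10 Ω}
    {q : L2Mat Ω × H10 Ω} :
    Tendsto (fun n => toTau (p n)) l (𝓝 (toTau q)) ↔
      Tendsto (fun n => (p n).1) l (𝓝 q.1) ∧
        Tendsto (fun n => toWeakSpace ℝ (H10 Ω) (p n).2) l (𝓝 (toWeakSpace ℝ (H10 Ω) q.2)) :=
  Prod.tendsto_iff _ _

theorem isWeakSolution_of_tendsto {ι : Type*} {l : Filter ι} [l.NeBot]
    {f : StrongDual ℝ (H10 Ω)} {p : ι → L2Mat Ω × H10 Ω} {q : L2Mat Ω × H10 Ω}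
    (hp : Tendsto (fun n => toTau (p n)) l (𝓝 (toTau q))) {R : ℝ} (hR : ∀ n, ‖(p n).2‖ ≤ R)
    (h : ∀ n, IsWeakSolution f (p n).1 (p n).2) : IsWeakSolution f q.1 q.2 := by
  intro φ
  obtain ⟨hA, hy⟩ := tendsto_toTau_iff.1 hp
  have h1 := tendsto_form_test ((continuous_symPart.tendsto _).comp hA) hR hy φ
  have h2 := tendsto_form_test ((continuous_skewPart.tendsto _).comp hA) hR hy φ
  refine tendsto_nhds_unique (h1.add h2) (Tendsto.congr (fun n => ?_) tendsto_const_nhds)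
  exact (h n φ).symm

/-- States with controls in a fixed compact set and norm at most `R` form a `τ`-compact set. -/
theorem isCompact_prod_toWeakSpace {𝒦 : Set (L2Mat Ω)} (h𝒦 : IsCompact 𝒦) (R : ℝ) :
    IsCompact (𝒦 ×ˢ (toWeakSpace ℝ (H10 Ω) '' Metric.closedBall 0 R)) :=
  h𝒦.prod (isCompact_image_toWeakSpace_closedBall R)

theorem cost_eq_of_isWeakSolution {α β b : ℝ} (hα : 0 < α) (hαβ : α ≤ β) (hb : 0 ≤ b)
    {p : L2Mat Ω × H10 Ω} (hA : BoundedControl α β b p.1) {f : StrongDual ℝ (H10 Ω)}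
    (hp : IsWeakSolution f p.1 p.2) (yd : L2 Ω) :
    cost yd p = ‖p.2.toL2 - yd‖ ^ 2 + f p.2 := by
  rw [cost, energy_identity hα hαβ hb hA hp]

theorem exists_isMinimizer (hN : 0 < N) (hΩ : Bornology.IsBounded (Ω : Set (Vec N)))
    {α β c b : ℝ} (hα : 0 < α) (hαβ : α ≤ β) (hc : 0 ≤ c) {Q : Set (L2Mat Ω)}
    (hQ : IsCompact Q) (hQ0 : (0 : L2Mat Ω) ∈ Q) {B : L2Mat Ω} (hb : 0 ≤ b)
    (hB : ∀ᵐ x ∂leb Ω, ‖B x‖ ≤ b) (yd : L2 Ω) (f : StrongDual ℝ (H10 Ω)) :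
    ∃ p, IsMinimizer yd (regularizedPairs α β c Q B f) p := by
  set X := regularizedPairs α β c Q B f with hX
  have hbc : ∀ p ∈ X, BoundedControl α β b p.1 := fun p hp => boundedControl_of_mem_Ad hB hp.1
  obtain ⟨R, hR⟩ := exists_norm_le_of_isWeakSolution hN hΩ hα hαβ f
  obtain ⟨𝒦, h𝒦, hsub⟩ := exists_isCompact_Ad_subset hΩ hα hαβ hc hQ
  have hne : X.Nonempty := by
    obtain ⟨A, hA⟩ := Ad_nonempty hΩ hαβ hQ0 B (c := c)
    obtain ⟨y, hy, -⟩ := existsUnique_isWeakSolution hN hΩ hα hαβ hb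
      (boundedControl_of_mem_Ad hB hA) f
    exact ⟨(A, y), hA, hy⟩
  have hbdd : BddBelow (cost yd '' X) := by
    refine ⟨0, ?_⟩
    rintro _ ⟨p, hp, rfl⟩
    refine add_nonneg (by positivity) (le_trans ?_ (le_trilinear_self hα hαβ (hbc p hp).sym _))
    positivity
  obtain ⟨v, -, hv, hvX⟩ := exists_seq_tendsto_sInf (hne.image _) hbdd
  choose p hpX hpv using hvX
  let U : Ultrafilter ℕ := Ultrafilter.of atTop
  have hU : (U : Filter ℕ) ≤ atTop := Ultrafilter.of_le _
  have hmem : ∀ n, toTau (p n) ∈ 𝒦 ×ˢ (toWeakSpace ℝ (H10 Ω) '' Metric.closedBall 0 R) :=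
    fun n => ⟨hsub B (hpX n).1, (p n).2,
      by simpa using hR b _ _ hb (hbc _ (hpX n)) (hpX n).2, rfl⟩
  obtain ⟨⟨A, w⟩, -, hlim⟩ := (isCompact_prod_toWeakSpace h𝒦 R).ultrafilter_le_nhds
    (U.map fun n => toTau (p n)) (by
      rw [Ultrafilter.coe_map, le_principal_iff, mem_map]
      exact Eventually.of_forall hmem)
  obtain ⟨y, rfl⟩ := (toWeakSpace ℝ (H10 Ω)).surjective w
  have hlim' : Tendsto (fun n => toTau (p n)) U (𝓝 (toTau (A, y))) := hlim
  have hy := tendsto_dual_of_tendsto_toWeakSpace (tendsto_toTau_iff.1 hlim').2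
  have hAX : (A, y) ∈ X :=
    ⟨mem_Ad_of_tendsto hc hQ.isClosed (tendsto_toTau_iff.1 hlim').1 tendsto_const_nhds
      fun n => (hpX n).1, isWeakSolution_of_tendsto hlim'
      (fun n => hR b _ _ hb (hbc _ (hpX n)) (hpX n).2) fun n => (hpX n).2⟩
  refine ⟨(A, y), hAX, isMinOn_iff.2 fun q hq => ?_⟩
  refine le_trans ?_ (csInf_le hbdd (Set.mem_image_of_mem _ hq))
  -- The square of the norm is bounded below by its tangent at the limit, which is weakly
  -- continuous in the state; the energy part of the cost is `f y`.
  let d : L2 Ω := y.toL2 - yd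
  let ℓ : StrongDual ℝ (H10 Ω) := (innerSL ℝ d).comp (toL2CLM Ω)
  have h1 : Tendsto (fun n => 2 * (ℓ (p n).2 - inner ℝ d yd) - ‖d‖ ^ 2 + f (p n).2) U
      (𝓝 (2 * (ℓ y - inner ℝ d yd) - ‖d‖ ^ 2 + f y)) :=
    (((hy ℓ).sub_const _).const_mul 2).sub_const _ |>.add (hy f)
  have h2 : cost yd (A, y) = 2 * (ℓ y - inner ℝ d yd) - ‖d‖ ^ 2 + f y := by
    rw [cost_eq_of_isWeakSolution hα hαβ hb (hbc _ hAX) hAX.2]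
    have : ℓ y - inner ℝ d yd = ‖d‖ ^ 2 := by
      change inner ℝ d y.toL2 - inner ℝ d yd = ‖d‖ ^ 2
      rw [← inner_sub_right, real_inner_self_eq_norm_sq]
    rw [this]
    ring
  rw [h2]
  refine le_of_tendsto_of_tendsto h1 (hv.mono_left hU) (Eventually.of_forall fun n => ?_)
  simp only
  rw [← hpv n, cost_eq_of_isWeakSolution hα hαβ hb (hbc _ (hpX n)) (hpX n).2]
  gcongr
  have h3 : ℓ (p n).2 - inner ℝ d yd = inner ℝ d ((p n).2.toL2 - yd) := by
    rw [inner_sub_right]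
    rfl
  rw [h3]
  have h4 := norm_sub_sq_real d ((p n).2.toL2 - yd)
  nlinarith [sq_nonneg ‖d - ((p n).2.toL2 - yd)‖]

/-- The lower bound of the elliptic quadratic form at `u` by its tangent at `w`. -/
theorem trilinear_tangent_le {α β : ℝ} (hα : 0 < α) (hαβ : α ≤ β) {S : L2Mat Ω}
    (hS : S ∈ elliptic Ω α β) (u w : L2Vec Ω) :
    2 * trilinear S u w - trilinear S w w ≤ trilinear S u u := by
  have h0 : 0 ≤ trilinear S (u - w) (u - w : L2Vec Ω) :=
    le_trans (by positivity) (le_trilinear_self hα hαβ hS (u - w))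
  have e : trilinear S (u - w) (u - w : L2Vec Ω) =
      trilinear S u u - trilinear S u w - (trilinear S w u - trilinear S w w) := by
    simp only [← boundedForm_apply S (hα.le.trans hαβ) (ae_norm_le_of_mem_elliptic hα hαβ hS),
      map_sub, _root_.sub_apply]
    ring
  rw [e, trilinear_comm hS.1 w u] at h0
  linarith

/-- In the limit the energy of the symmetric part can only drop: the elliptic energy is lower
semicontinuous, and along bounded controls it equals `f (y n)`. -/
theorem form_symPart_self_le_of_tendsto {ι : Type*} {l : Filter ι} [l.NeBot] {α β : ℝ}
    (hα : 0 < α) (hαβ : α ≤ β) {f : StrongDual ℝ (H10 Ω)} {p : ι → L2Mat Ω × H10 Ω}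
    {q : L2Mat Ω × H10 Ω} (hp : Tendsto (fun n => toTau (p n)) l (𝓝 (toTau q))) {R : ℝ}
    (hR : ∀ n, ‖(p n).2‖ ≤ R) (hS : ∀ n, symPart (p n).1 ∈ elliptic Ω α β)
    (hE : ∀ n, form (symPart (p n).1) (p n).2 (p n).2.grad = f (p n).2) :
    form (symPart q.1) q.2 q.2.grad ≤ f q.2 := by
  obtain ⟨hA, hy⟩ := tendsto_toTau_iff.1 hp
  have hsym : Tendsto (fun n => symPart (p n).1) l (𝓝 (symPart q.1)) :=
    (continuous_symPart.tendsto _).comp hA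
  have hSq : symPart q.1 ∈ elliptic Ω α β :=
    (isClosed_elliptic α β).mem_of_tendsto hsym (Eventually.of_forall hS)
  let E := boundedForm (symPart q.1) (hα.le.trans hαβ) (ae_norm_le_of_mem_elliptic hα hαβ hSq)
  -- The tangent at a test function is continuous under strong times weak convergence; the tangent
  -- at `q.2` itself is reached by density.
  have htest : ∀ φ : 𝓓(Ω, ℝ),
      2 * E q.2.grad (testH10 φ).grad - E (testH10 φ).grad (testH10 φ).grad ≤ f q.2 := by
    intro φ
    have h1 := tendsto_form_test hsym hR hy φ
    have h2 := tendsto_form_test hsym (y := fun _ => testH10 φ) (R := ‖testH10 φ‖)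
      (fun _ => le_rfl) tendsto_const_nhds φ
    have h3 := tendsto_dual_of_tendsto_toWeakSpace hy f
    simp only [form_test] at h1 h2
    refine le_of_tendsto_of_tendsto ((h1.const_mul 2).sub h2) h3 (Eventually.of_forall fun n => ?_)
    simp only
    rw [← hE n]
    exact trilinear_tangent_le hα hαβ (hS n) _ _
  have hclosed : IsClosed {v : H10 Ω | 2 * E q.2.grad v.grad - E v.grad v.grad ≤ f q.2} := by
    refine isClosed_le ?_ continuous_const
    have hg : Continuous fun v : H10 Ω => v.grad := (gradCLM Ω).continuous
    fun_prop
  have := denseRange_testH10.induction_on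
    (p := fun v => 2 * E q.2.grad v.grad - E v.grad v.grad ≤ f q.2) q.2 hclosed htest
  have e : E q.2.grad q.2.grad = form (symPart q.1) q.2 q.2.grad := rfl
  linarith

end

end EllipticControl

open EllipticControl in
theorem theorem4p1 {N : ℕ} (hN : 2 ≤ N)
    (Ω : TopologicalSpace.Opens (EllipticControl.Vec N))
    (hΩ : Bornology.IsBounded (Ω : Set (EllipticControl.Vec N)))
    (α β c : ℝ) (hα : 0 < α) (hαβ : α ≤ β) (hc : 0 < c)
    -- the compact convex set of skew-symmetric matrices
    (Q : Set (EllipticControl.L2Mat Ω)) (hQskew : Q ⊆ EllipticControl.SkewL2 Ω)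
    (hQconv : Convex ℝ Q) (hQcomp : IsCompact Q) (hQ0 : (0 : EllipticControl.L2Mat Ω) ∈ Q)
    -- the majorant and its approximation by essentially bounded skew-symmetric matrices
    (Astar : EllipticControl.L2Mat Ω) (hAstar : Astar ∈ EllipticControl.SkewL2 Ω)
    (Ak : ℕ → EllipticControl.L2Mat Ω) (hAkskew : ∀ k, Ak k ∈ EllipticControl.SkewL2 Ω)
    (hAkbdd : ∀ k, MemLp (Ak k) ⊤ (EllipticControl.leb Ω))
    (hAklim : Tendsto Ak atTop (𝓝 Astar))
    (yd : EllipticControl.L2 Ω) (f : StrongDual ℝ (EllipticControl.H10 Ω)) :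
    -- each admissible control of a regularized problem has exactly one state
    (∀ k, ∀ A ∈ EllipticControl.Ad α β c Q (Ak k),
      ∃! y : EllipticControl.H10 Ω, EllipticControl.IsWeakSolution f A y) ∧
    -- each regularized problem has a minimizer
    (∀ k, ∃ p, EllipticControl.IsMinimizer yd
      (EllipticControl.regularizedPairs α β c Q (Ak k) f) p) ∧
    -- every sequence of minimizers is relatively compact, with admissible cluster pairs
    (∀ p : ℕ → EllipticControl.L2Mat Ω × EllipticControl.H10 Ω,
      (∀ k, EllipticControl.IsMinimizer yd
        (EllipticControl.regularizedPairs α β c Q (Ak k) f) (p k)) →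
      IsCompact (closure (Set.range fun k => EllipticControl.toTau (p k))) ∧
      ∀ q : EllipticControl.L2Mat Ω × EllipticControl.H10 Ω,
        MapClusterPt (EllipticControl.toTau q) atTop (fun k => EllipticControl.toTau (p k)) →
        q ∈ EllipticControl.admissiblePairs α β c Q Astar f ∧
        0 ≤ EllipticControl.bracket q.1 q.2 q.2) := by
  have hN0 : 0 < N := by omega
  choose b hb hB using fun k => exists_ae_norm_le_of_memLp_top (hAkbdd k)
  obtain ⟨R, hR⟩ := exists_norm_le_of_isWeakSolution hN0 hΩ hα hαβ f
  have hbc : ∀ k, ∀ A ∈ Ad α β c Q (Ak k), BoundedControl α β (b k) A := fun k A hA =>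
    boundedControl_of_mem_Ad (hB k) hA
  refine ⟨fun k A hA => existsUnique_isWeakSolution hN0 hΩ hα hαβ (hb k) (hbc k A hA) f,
    fun k => exists_isMinimizer hN0 hΩ hα hαβ hc.le hQcomp hQ0 (hb k) (hB k) yd f,
    fun p hp => ?_⟩
  have hpR : ∀ k, ‖(p k).2‖ ≤ R := fun k =>
    hR (b k) _ _ (hb k) (hbc k _ (hp k).1.1) (hp k).1.2
  constructor
  · obtain ⟨𝒦, h𝒦, hsub⟩ := exists_isCompact_Ad_subset hΩ hα hαβ hc.le hQcomp
    refine (isCompact_prod_toWeakSpace h𝒦 R).closure_of_subset ?_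
    rintro _ ⟨k, rfl⟩
    exact ⟨hsub _ (hp k).1.1, (p k).2, by simpa using hpR k, rfl⟩
  · intro q hq
    obtain ⟨U, hU, hlim⟩ := mapClusterPt_iff_ultrafilter.1 hq
    have hAd : q.1 ∈ Ad α β c Q Astar :=
      mem_Ad_of_tendsto hc.le hQcomp.isClosed (tendsto_toTau_iff.1 hlim).1
        (hAklim.mono_left hU) fun k => (hp k).1.1
    have hsol : IsWeakSolution f q.1 q.2 :=
      isWeakSolution_of_tendsto hlim hpR fun k => (hp k).1.2
    obtain ⟨hD, hbr⟩ := mem_D_and_bracket_eq hN0 hΩ hα hαβ hAd.1.2 hsol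
    refine ⟨⟨hAd, hD, fun v => ?_⟩, ?_⟩
    · rw [hbr]
      ring
    · rw [hbr, sub_nonneg]
      exact form_symPart_self_le_of_tendsto hα hαβ hlim hpR (fun k => (hp k).1.1.1.2) fun k =>
        energy_identity hα hαβ (hb k) (hbc k _ (hp k).1.1) (hp k).1.2
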